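/- **Definitions.** A *partial commutative monoid* (PCM) is a set with an element $0$ and a partial binary operation $\oplus$ that is associative, commutative and has unit $0$ (all in the sense of Kleene equality); $x\perp y$ means that $x\oplus y$ is defined, and $x\le y$ means that $x\oplus z=y$ for some $z$. A map of PCMs is *additive* if it preserves $0$ and all existing sums. An *effect algebra* is a PCM with an element $1$ such that each $x$ has a unique $x^\perp$ with $x\oplus x^\perp=1$, and $x\perp 1$ implies $x=0$. Let $\mathbf{EA}$ be the category of effect algebras and additive maps, and $\mathbf{OA}$ its full subcategory of *orthoalgebras*, the effect algebras in which $a\perp a$ implies $a=0$. An effect algebra is *directed complete* if every upwards-directed subset has a supremum. A *convex action* on $E$ is a map $[0,1]\times E\to E$ with $\lambda(\mu x)=(\lambda\mu)x$, $1x=x$, $\lambda x\oplus\mu x=(\lambda+\mu)x$ whenever $\lambda+\mu\le 1$, and $\lambda(x\oplus y)=\lambda x\oplus\lambda y$ whenever $x\perp y$. Let $\mathbf{DCEA}_c$ be the category of directed-complete effect algebras with a convex action, and additive maps that preserve the action. An *order unit space* is an ordered real vector space $V$ with an order unit $1\geq 0$ such that $\|v\|=\inf\{\lambda\ge 0: -\lambda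 1\le v\le\lambda 1\}$ is a norm for which the positive cone is closed. Let $\mathbf{DCOUS}$ be the category of order unit spaces whose unit interval $[0,1]_V$ is directed complete, with positive linear contractions. An *effectus* (in partial form) is a category $\mathbf C$ with finite coproducts, whose hom-sets are PCMs with biadditive composition, and with a distinguished object $I$, such that: (i) if $h\colon A\to B+B$, then $\vartriangleright_1\circ h\perp \vartriangleright_2\circ h$, where $\vartriangleright_1=[\mathrm{id},0]$ and $\vartriangleright_2=[0,\mathrm{id}]$; (ii) if $f\perp g\colon A\to B$, then $\kappa_1\circ f\perp\kappa_2\circ g$, where $\kappa_i\colon B\to B+B$ are the coprojections; (iii) each $\mathrm{Pred}(A):=\mathbf C(A,I)$ is an effect algebra, with top $\mathbf 1_A$; (iv) $\mathbf 1\circ f=0$ implies $f=0$; (v) $\mathbf 1\circ f\perp\mathbf 1\circ g$ implies $f\perp g$. Precomposition makes $\mathrm{Pred}$ a functor $\mathbf C\to\mathbf{EA}^{\mathrm{op}}$. A *functor of effectuses* preserves the partial sums of maps, finite coproducts, and, up to isomorphism, $I$ with the maps $\mathbf 1_A$. A *state* on $A$ is a map $\omega\colon I\to A$ with $\mathbf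 1_A\circ\omega=\mathbf 1_I$. An effectus is *directed complete* if all $\mathrm{Pred}(A)$ are. It is *separated by states* if parallel maps $f,g\colon A\to B$ with $f\circ\omega=g\circ\omega$ for all states $\omega$ on $A$ are equal. It *has images* if for every $f\colon A\to B$ there is a least $p\in\mathrm{Pred}(B)$ with $p\circ f=\mathbf 1\circ f$, the image of $f$; a predicate is *sharp* if it is the image of some map. A *comprehension* for $p\in\mathrm{Pred}(A)$ is a map $\pi\colon A_p\to A$ with $\mathbf 1\circ\pi=p\circ\pi$ through which every $f\colon B\to A$ with $\mathbf 1\circ f=p\circ f$ factors uniquely. A *filter* for $p$ is a map $\xi\colon A\to A^p$ with $\mathbf 1\circ\xi\le p$ through which every $f\colon A\to B$ with $\mathbf 1\circ f\le p$ factors uniquely. The effectus *has compatible filters and comprehensions* if every predicate has a filter and a comprehension, and for every comprehension $\pi$ of a sharp predicate $p$ there is a filter $\xi$ of $p$ with $\xi\circ\pi=\mathrm{id}$. **Proposition.** Let $\mathbf C$ be a directed-complete effectus that is separated by states and has images and compatible filters and comprehensions. Then there are effectuses $\mathbf C_1$ and $\mathbf C_2$ and an equivalence of categories $\mathbf C\simeq\mathbf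 C_1\times\mathbf C_2$ whose components $\mathbf C\to\mathbf C_1$ and $\mathbf C\to\mathbf C_2$ are functors of effectuses, such that 1. the predicate functor of $\mathbf C_1$ factors through $\mathbf{OA}^{\mathrm{op}}$; in particular the predicate spaces of $\mathbf C_1$ are orthoalgebras; 2. the predicate functor of $\mathbf C_2$ lifts to a functor $\mathbf C_2\to\mathbf{DCEA}_c^{\mathrm{op}}$; in particular the predicate spaces of $\mathbf C_2$ are directed-complete convex effect algebras; 3. the functor $\mathbf{DCOUS}\to\mathbf{DCEA}_c$, $V\mapsto[0,1]_V$, is an equivalence of categories. Consequently the functor in 2 is, up to natural isomorphism, a functor $\mathbf C_2\to\mathbf{DCOUS}^{\mathrm{op}}$ followed by $V\mapsto[0,1]_V$. -/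

import Mathlib

open CategoryTheory CategoryTheory.Limits Opposite

universe u v w

namespace EffTheory

/-! ### Partial commutative monoids and effect algebras -/

/-- A partial commutative monoid.  The value `none` of `oplus x y` means that the sum of `x` and `y`
is undefined, so that the equations below are Kleene equalities. -/
class PCM (M : Type v) where
  zero : M
  oplus : M → M → Option M
  oplus_assoc : ∀ x y z : M,
    ((oplus x y).bind fun t => oplus t z) = ((oplus y z).bind fun t => oplus x t)
  oplus_comm : ∀ x y : M, oplus x y = oplus y x
  zero_oplus : ∀ x : M, oplus zero x = some x

/-- `x` and `y` are summable. -/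
def Perp {M : Type v} [PCM M] (x y : M) : Prop := ∃ z, PCM.oplus x y = some z

/-- The algebraic (pre)order of a partial commutative monoid. -/
def PLe {M : Type v} [PCM M] (x y : M) : Prop := ∃ z, PCM.oplus x z = some y

/-- Additive functions: they preserve zero and all existing sums. -/
def IsAdditive {M : Type v} {N : Type w} [PCM M] [PCM N] (f : M → N) : Prop :=
  f PCM.zero = PCM.zero ∧
    ∀ x y z : M, PCM.oplus x y = some z → PCM.oplus (f x) (f y) = some (f z)

/-- The partial commutative monoid `M` is an effect algebra with top element `one`. -/
structure IsEffectAlgebra {M : Type v} [PCM M] (one : M) : Prop where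
  existsUnique_ortho : ∀ x : M, ∃! y : M, PCM.oplus x y = some one
  eq_zero_of_perp_one : ∀ x : M, Perp x one → x = PCM.zero

/-- Zero is the only self-summable element. -/
def IsOrthoalgebra (M : Type v) [PCM M] : Prop := ∀ a : M, Perp a a → a = PCM.zero

/-- Every directed subset has a supremum, for an order relation `r`. -/
def IsDirectedComplete {X : Type v} (r : X → X → Prop) : Prop :=
  ∀ U : Set X, DirectedOn r U →
    ∃ s, (∀ x ∈ U, r x s) ∧ ∀ b, (∀ x ∈ U, r x b) → r s b

/-- A convex action of the real unit interval. -/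
structure ConvexAction (M : Type v) [PCM M] where
  act : Set.Icc (0 : ℝ) 1 → M → M
  act_act : ∀ (l m : Set.Icc (0 : ℝ) 1) (x : M), act l (act m x) = act (l * m) x
  act_add : ∀ (l m n : Set.Icc (0 : ℝ) 1) (x : M), (l : ℝ) + m = n →
    PCM.oplus (act l x) (act m x) = some (act n x)
  one_act : ∀ x : M, act 1 x = x
  act_oplus : ∀ (l : Set.Icc (0 : ℝ) 1) (x y z : M), PCM.oplus x y = some z →
    PCM.oplus (act l x) (act l y) = some (act l z)

/-! ### The categories of effect algebras, of orthoalgebras and of convex effect algebras -/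

/-- Effect algebras (objects). -/
structure EA : Type (v + 1) where
  carrier : Type v
  [pcm : PCM carrier]
  one : carrier
  isEffectAlgebra : IsEffectAlgebra one

attribute [instance] EA.pcm

/-- Morphisms of effect algebras: additive maps (not necessarily preserving the top). -/
@[ext]
structure EA.Hom (E F : EA.{v}) where
  toFun : E.carrier → F.carrier
  additive : IsAdditive toFun

instance : Category EA.{v} where
  Hom := EA.Hom
  id E := ⟨id, rfl, fun _ _ _ h => h⟩
  comp f g := ⟨g.toFun ∘ f.toFun, by
    simp only [Function.comp, f.additive.1, g.additive.1],
    fun _ _ _ h => g.additive.2 _ _ _ (f.additive.2 _ _ _ h)⟩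

/-- The full subcategory of orthoalgebras. -/
abbrev OA : Type (v + 1) :=
  ObjectProperty.FullSubcategory (fun E : EA.{v} => IsOrthoalgebra E.carrier)

/-- The inclusion of orthoalgebras in effect algebras. -/
abbrev OA.incl : OA.{v} ⥤ EA.{v} :=
  ObjectProperty.ι (fun E : EA.{v} => IsOrthoalgebra E.carrier)

/-- Directed-complete convex effect algebras (objects). -/
structure DCEAc : Type (v + 1) where
  toEA : EA.{v}
  action : ConvexAction toEA.carrier
  directedComplete : IsDirectedComplete (PLe (M := toEA.carrier))

/-- Additive maps that preserve the convex action. -/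
@[ext]
structure DCEAc.Hom (E F : DCEAc.{v}) where
  hom : E.toEA ⟶ F.toEA
  map_act : ∀ l x, hom.toFun (E.action.act l x) = F.action.act l (hom.toFun x)

instance : Category DCEAc.{v} where
  Hom := DCEAc.Hom
  id E := ⟨𝟙 E.toEA, fun _ _ => rfl⟩
  comp f g := ⟨f.hom ≫ g.hom, fun l x => by
    change g.hom.toFun (f.hom.toFun _) = _
    rw [f.map_act, g.map_act]
    rfl⟩

/-- The functor forgetting the convex action. -/
def DCEAc.forget : DCEAc.{v} ⥤ EA.{v} where
  obj E := E.toEA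
  map f := DCEAc.Hom.hom f

/-! ### Order unit spaces -/

section OUS

variable {V : Type v} [AddCommGroup V] [Module ℝ V] [PartialOrder V]

/-- The (semi)norm induced by an order unit `e`. -/
noncomputable def ouNorm (e v : V) : ℝ :=
  sInf {l : ℝ | 0 ≤ l ∧ -(l • e) ≤ v ∧ v ≤ l • e}

/-- `e` is an order unit of the ordered vector space `V`, the induced seminorm is a norm, and
the positive cone is closed for it. -/
structure IsOrderUnitSpace (e : V) : Prop where
  unit_nonneg : 0 ≤ e
  order_unit : ∀ v : V, ∃ l : ℝ, 0 ≤ l ∧ -(l • e) ≤ v ∧ v ≤ l • e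
  norm_eq_zero : ∀ v : V, ouNorm e v = 0 → v = 0
  cone_closed : ∀ v : V, (∀ ε : ℝ, 0 < ε → ∃ p : V, 0 ≤ p ∧ ouNorm e (v - p) < ε) → 0 ≤ v

theorem ouNorm_le {e v : V} {l : ℝ} (hl : 0 ≤ l) (h1 : -(l • e) ≤ v) (h2 : v ≤ l • e) :
    ouNorm e v ≤ l :=
  csInf_le ⟨0, fun _ h => h.1⟩ ⟨hl, h1, h2⟩

variable [IsOrderedAddMonoid V] [IsOrderedModule ℝ V]

theorem le_of_ouNorm_lt {e v : V} (h : IsOrderUnitSpace e) {l : ℝ} (hv : ouNorm e v < l) :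
    v ≤ l • e := by
  obtain ⟨m, ⟨_, _, h2⟩, hm⟩ := exists_lt_of_csInf_lt (h.order_unit v) hv
  exact h2.trans (smul_le_smul_of_nonneg_right hm.le h.unit_nonneg)

theorem le_unit_of_ouNorm_le {e v : V} (h : IsOrderUnitSpace e) (hv : ouNorm e v ≤ 1) :
    v ≤ e := by
  have key : 0 ≤ e - v := by
    refine h.cone_closed _ fun ε hε => ?_
    refine ⟨(1 + ε / 2) • e - v, sub_nonneg.2 (le_of_ouNorm_lt h (by linarith)), ?_⟩
    have e1 : e - v - ((1 + ε / 2) • e - v) = -((ε / 2) • e) := by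
      rw [add_smul, one_smul]; abel
    have h0 : 0 ≤ (ε / 2) • e := smul_nonneg (by linarith) h.unit_nonneg
    rw [e1]
    have := ouNorm_le (e := e) (v := -((ε / 2) • e)) (l := ε / 2) (by linarith) le_rfl
      ((neg_nonpos.2 h0).trans h0)
    linarith
  exact sub_nonneg.1 key

end OUS

/-- Directed-complete order unit spaces (objects). -/
structure DCOUS : Type (v + 1) where
  carrier : Type v
  [addCommGroup : AddCommGroup carrier]
  [module : Module ℝ carrier]
  [partialOrder : PartialOrder carrier]
  [isOrderedAddMonoid : IsOrderedAddMonoid carrier]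
  [isOrderedModule : IsOrderedModule ℝ carrier]
  unit : carrier
  isOrderUnitSpace : IsOrderUnitSpace unit
  directedComplete : IsDirectedComplete (fun x y : Set.Icc (0 : carrier) unit => x ≤ y)

attribute [instance] DCOUS.addCommGroup DCOUS.module DCOUS.partialOrder
  DCOUS.isOrderedAddMonoid DCOUS.isOrderedModule

/-- Positive linear contractions, for the order unit norms. -/
@[ext]
structure DCOUS.Hom (V W : DCOUS.{v}) where
  toLin : V.carrier →ₗ[ℝ] W.carrier
  nonneg : ∀ x, 0 ≤ x → 0 ≤ toLin x
  contraction : ∀ x, ouNorm W.unit (toLin x) ≤ ouNorm V.unit x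

instance : Category DCOUS.{v} where
  Hom := DCOUS.Hom
  id V := ⟨LinearMap.id, fun _ h => h, fun _ => le_rfl⟩
  comp f g := ⟨g.toLin ∘ₗ f.toLin, fun x h => g.nonneg _ (f.nonneg x h),
    fun x => (g.contraction _).trans (f.contraction x)⟩

namespace DCOUS

open Classical in
/-- The unit interval, with the partial addition that is defined when the sum is at most the
unit. -/
noncomputable instance intervalPCM (V : DCOUS.{v}) : PCM (Set.Icc (0 : V.carrier) V.unit) where
  zero := ⟨0, le_rfl, V.isOrderUnitSpace.unit_nonneg⟩
  oplus x y :=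
    if h : (x : V.carrier) + y ≤ V.unit then some ⟨x + y, add_nonneg x.2.1 y.2.1, h⟩ else none
  oplus_assoc x y z := by
    by_cases hs : (x : V.carrier) + y + z ≤ V.unit
    · have h1 : (x : V.carrier) + y ≤ V.unit := (le_add_of_nonneg_right z.2.1).trans hs
      have h2 : (y : V.carrier) + z ≤ V.unit := by
        refine le_trans ?_ hs
        rw [add_assoc]
        exact le_add_of_nonneg_left x.2.1
      have h3 : (x : V.carrier) + (y + z) ≤ V.unit := by rwa [← add_assoc]
      simp [h1, h2, h3, add_assoc]
    · have h3 : ¬ (x : V.carrier) + (y + z) ≤ V.unit := by rwa [← add_assoc]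
      by_cases h1 : (x : V.carrier) + y ≤ V.unit <;>
        by_cases h2 : (y : V.carrier) + z ≤ V.unit <;> simp [h1, h2, hs, h3]
  oplus_comm x y := by
    simp only [add_comm]
  zero_oplus x := by
    have : (x : V.carrier) ≤ V.unit := x.2.2
    simp [this]

open Classical in
theorem oplus_eq_some {V : DCOUS.{v}} {x y z : Set.Icc (0 : V.carrier) V.unit} :
    PCM.oplus x y = some z ↔ (x : V.carrier) + y = z := by
  change (if h : (x : V.carrier) + y ≤ V.unit then
    some (⟨x + y, add_nonneg x.2.1 y.2.1, h⟩ : Set.Icc (0 : V.carrier) V.unit) else none)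
      = some z ↔ _
  constructor
  · intro h
    split_ifs at h with h1
    exact congrArg Subtype.val (Option.some.inj h)
  · intro h
    have h1 : (x : V.carrier) + y ≤ V.unit := h ▸ z.2.2
    rw [dif_pos h1]
    exact congrArg some (Subtype.ext h)

theorem pLe_iff {V : DCOUS.{v}} {x y : Set.Icc (0 : V.carrier) V.unit} : PLe x y ↔ x ≤ y := by
  constructor
  · rintro ⟨z, hz⟩
    have := oplus_eq_some.1 hz
    exact Subtype.coe_le_coe.1 (this ▸ le_add_of_nonneg_right z.2.1)
  · intro h
    have h' : (x : V.carrier) ≤ y := h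
    exact ⟨⟨y - x, sub_nonneg.2 h', (sub_le_self _ x.2.1).trans y.2.2⟩,
      oplus_eq_some.2 (by simp)⟩

/-- The unit interval of a directed-complete order unit space, as an effect algebra. -/
noncomputable def intervalEA (V : DCOUS.{v}) : EA.{v} where
  carrier := Set.Icc (0 : V.carrier) V.unit
  one := ⟨V.unit, V.isOrderUnitSpace.unit_nonneg, le_rfl⟩
  isEffectAlgebra :=
    { existsUnique_ortho := fun x => by
        refine ⟨⟨V.unit - x, sub_nonneg.2 x.2.2, sub_le_self _ x.2.1⟩,
          oplus_eq_some.2 (by simp), fun y hy => ?_⟩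
        have := oplus_eq_some.1 hy
        exact Subtype.ext (eq_sub_of_add_eq' this)
      eq_zero_of_perp_one := fun x ⟨z, hz⟩ => by
        have h1 := oplus_eq_some.1 hz
        have h2 : (x : V.carrier) + V.unit ≤ V.unit := by
          have := z.2.2
          rw [← h1] at this
          exact this
        have h3 : (x : V.carrier) ≤ 0 := by simpa using h2
        exact Subtype.ext (le_antisymm h3 x.2.1) }

/-- The scalar multiplication on the unit interval. -/
noncomputable def intervalAction (V : DCOUS.{v}) :
    ConvexAction (Set.Icc (0 : V.carrier) V.unit) where
  act l x := ⟨(l : ℝ) • (x : V.carrier), smul_nonneg l.2.1 x.2.1,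
    (smul_le_of_le_one_left x.2.1 l.2.2).trans x.2.2⟩
  act_act l m x := Subtype.ext (by simp [mul_smul])
  act_add l m n x h := oplus_eq_some.2 (by simp [← h, add_smul])
  one_act x := Subtype.ext (by simp)
  act_oplus l x y z h := oplus_eq_some.2 (by
    have := oplus_eq_some.1 h
    simp [← this])

/-- The unit interval with its scalar multiplication, as a convex effect algebra. -/
noncomputable def intervalDCEAc (V : DCOUS.{v}) : DCEAc.{v} where
  toEA := V.intervalEA
  action := V.intervalAction
  directedComplete := by
    have : (PLe (M := V.intervalEA.carrier)) =
        (fun x y : Set.Icc (0 : V.carrier) V.unit => x ≤ y) := by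
      funext x y
      exact propext pLe_iff
    rw [this]
    exact V.directedComplete

theorem Hom.map_le_unit {V W : DCOUS.{v}} (f : DCOUS.Hom V W) {x : V.carrier}
    (h0 : 0 ≤ x) (h1 : x ≤ V.unit) : f.toLin x ≤ W.unit :=
  le_unit_of_ouNorm_le W.isOrderUnitSpace ((f.contraction x).trans
    (ouNorm_le zero_le_one
      (by rw [one_smul]; exact (neg_nonpos.2 V.isOrderUnitSpace.unit_nonneg).trans h0)
      (by rwa [one_smul])))

/-- The functor that sends an order unit space to its unit interval and restricts maps. -/
noncomputable def interval : DCOUS.{v} ⥤ DCEAc.{v} where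
  obj V := V.intervalDCEAc
  map {V W} f :=
    { hom :=
        { toFun := fun x => ⟨DCOUS.Hom.toLin f x.1, DCOUS.Hom.nonneg f _ x.2.1,
            DCOUS.Hom.map_le_unit f x.2.1 x.2.2⟩
          additive := ⟨Subtype.ext (map_zero _), fun x y z h => oplus_eq_some.2 (by
            have := oplus_eq_some.1 h
            change DCOUS.Hom.toLin f _ + DCOUS.Hom.toLin f _ = DCOUS.Hom.toLin f _
            rw [← map_add, this])⟩ }
      map_act := fun l x => Subtype.ext ((DCOUS.Hom.toLin f).map_smul (l : ℝ) x.1) }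

end DCOUS

/-! ### Effectuses in partial form -/

/-- A category enriched over partial commutative monoids. -/
class PCMEnriched (C : Type u) [Category.{v} C] where
  homPCM : ∀ A B : C, PCM (A ⟶ B)
  comp_additive_right : ∀ {A B D : C} (f : A ⟶ B), IsAdditive (fun g : B ⟶ D => f ≫ g)
  comp_additive_left : ∀ {A B D : C} (g : B ⟶ D), IsAdditive (fun f : A ⟶ B => f ≫ g)

attribute [reducible] PCMEnriched.homPCM
attribute [instance] PCMEnriched.homPCM

/-- A finitely partially additive category.  The morphisms `coprod.desc (𝟙 B) 0` and
`coprod.desc 0 (𝟙 B)` are the two partial projections of `B ⨿ B`. -/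
class FinPAC (C : Type u) [Category.{v} C] extends HasFiniteCoproducts C, PCMEnriched C where
  compatible_sum : ∀ {A B : C} (f g : A ⟶ B),
    (∃ h : A ⟶ B ⨿ B, h ≫ coprod.desc (𝟙 B) PCM.zero = f ∧
      h ≫ coprod.desc PCM.zero (𝟙 B) = g) → Perp f g
  untying : ∀ {A B : C} (f g : A ⟶ B), Perp f g →
    Perp (f ≫ (coprod.inl : B ⟶ B ⨿ B)) (g ≫ (coprod.inr : B ⟶ B ⨿ B))

/-- An effectus in partial form, with unit object `unit`; `truth A` is the top predicate. -/
class Effectus (C : Type u) [Category.{v} C] extends FinPAC C where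
  unit : C
  truth : ∀ A : C, A ⟶ unit
  isEffectAlgebra : ∀ A : C, IsEffectAlgebra (truth A)
  eq_zero_of_comp_truth : ∀ {A B : C} (f : A ⟶ B), f ≫ truth B = PCM.zero → f = PCM.zero
  perp_of_comp_truth : ∀ {A B : C} (f g : A ⟶ B),
    Perp (f ≫ truth B) (g ≫ truth B) → Perp f g

section

variable {C : Type u} [Category.{v} C] [Effectus C]

/-- Predicates on `A`. -/
abbrev Predicate (A : C) : Type v := A ⟶ (Effectus.unit : C)

/-- Total maps. -/
def IsTotal {A B : C} (f : A ⟶ B) : Prop := f ≫ Effectus.truth B = Effectus.truth A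

/-- `p` is the image of `f`. -/
def IsImage {A B : C} (f : A ⟶ B) (p : Predicate B) : Prop :=
  f ≫ p = f ≫ Effectus.truth B ∧ ∀ q : Predicate B, f ≫ q = f ≫ Effectus.truth B → PLe p q

/-- `p` is sharp: it is the image of some map. -/
def IsSharp {A : C} (p : Predicate A) : Prop := ∃ (B : C) (f : B ⟶ A), IsImage f p

/-- `π` is a comprehension for `p`. -/
def IsComprehension {A X : C} (p : Predicate A) (π : X ⟶ A) : Prop :=
  π ≫ Effectus.truth A = π ≫ p ∧
    ∀ (B : C) (f : B ⟶ A), f ≫ Effectus.truth A = f ≫ p → ∃! g : B ⟶ X, g ≫ π = f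

/-- `ξ` is a filter for `p`. -/
def IsFilter {A X : C} (p : Predicate A) (ξ : A ⟶ X) : Prop :=
  PLe (ξ ≫ Effectus.truth X) p ∧
    ∀ (B : C) (f : A ⟶ B), PLe (f ≫ Effectus.truth B) p → ∃! g : X ⟶ B, ξ ≫ g = f

end

section

variable (C : Type u) [Category.{v} C] [Effectus C]

/-- All predicate spaces are directed complete. -/
def DirectedCompleteEffectus : Prop := ∀ A : C, IsDirectedComplete (PLe (M := Predicate A))

/-- Maps that agree on all states (total maps from the unit object) are equal. -/
def SeparatedByStates : Prop := ∀ (A B : C) (f g : A ⟶ B),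
  (∀ ω : (Effectus.unit : C) ⟶ A, IsTotal ω → ω ≫ f = ω ≫ g) → f = g

/-- Every map has an image. -/
def EffHasImages : Prop := ∀ (A B : C) (f : A ⟶ B), ∃ p : Predicate B, IsImage f p

/-- Every predicate has a comprehension. -/
def HasComprehensions : Prop :=
  ∀ (A : C) (p : Predicate A), ∃ (X : C) (π : X ⟶ A), IsComprehension p π

/-- Every predicate has a filter. -/
def HasFilters : Prop :=
  ∀ (A : C) (p : Predicate A), ∃ (X : C) (ξ : A ⟶ X), IsFilter p ξ

/-- Every comprehension of a sharp predicate `p` is a section of some filter of `p`. -/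
def FiltersComprehensionsCompatible : Prop :=
  ∀ (A X : C) (p : Predicate A) (π : X ⟶ A), IsSharp p → IsComprehension p π →
    ∃ ξ : A ⟶ X, IsFilter p ξ ∧ π ≫ ξ = 𝟙 X

/-- The predicate functor. -/
def predFunctor : C ⥤ EA.{v}ᵒᵖ where
  obj A := op
    { carrier := Predicate A
      one := Effectus.truth A
      isEffectAlgebra := Effectus.isEffectAlgebra A }
  map f := Quiver.Hom.op
    { toFun := fun p => f ≫ p
      additive := PCMEnriched.comp_additive_right f }
  map_id _ := Quiver.Hom.unop_inj (EA.Hom.ext (funext fun p => Category.id_comp p))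
  map_comp f g := Quiver.Hom.unop_inj (EA.Hom.ext (funext fun p => Category.assoc f g p))

end

/-- Functors of effectuses: they preserve the partial addition of maps, finite coproducts, and,
up to isomorphism, the unit object with its truth predicates. -/
structure IsEffectusFunctor {C : Type u} [Category.{v} C] [Effectus C]
    {D : Type u} [Category.{v} D] [Effectus D] (F : C ⥤ D) : Prop where
  additive : ∀ A B : C, IsAdditive (fun f : A ⟶ B => F.map f)
  preservesFiniteCoproducts : PreservesFiniteCoproducts F
  unit : ∃ i : F.obj Effectus.unit ≅ Effectus.unit,
    ∀ A : C, F.map (Effectus.truth A) ≫ i.hom = Effectus.truth (F.obj A)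

end EffTheory

open EffTheory

/-! The endomorphisms of the unit object, the scalars, form a directed-complete effect algebra with
a multiplication. Zorn's lemma gives a maximal scalar `m` that is summable with itself; let `s = m ⊕
m` and let `t` be the complement of `s`. If `k ⊕ k ≤ t`, then `m ⊕ k` is still self-summable, so `k
= 0` by maximality. Hence `t` annihilates every self-summable scalar, in particular `m`, and `s`,
`t` are orthogonal idempotents with sum `1` (`exists_scalarSplitting`).

Every object splits along them: a comprehension for the predicate `s`, with a compatible filter for
its image, is a retract, likewise for `t`, and states show that the two retractions sum to the
identity (`exists_summands`). There are no nonzero maps between an object fixed by `s` and one fixed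
by `t`, so the category is the product of the two full subcategories
(`isEquivalence_prod_summandFunctor`). In the `t`-part, a self-summable predicate has self-summable
values at states; these are killed by `t` and also fixed by it, so the predicate vanishes. In the
`s`-part, composition with the compression of `m` halves every predicate.

It remains to see that halving and directed completeness produce real scalars. Such an effect
algebra is the unit interval of a partially ordered group (`exists_isUnitInterval`). Directed
suprema make this group Archimedean, and real multiples of positive elements are suprema of dyadic
ones, so the group is an order unit space (`exists_dcous`). Additive maps out of the real unit
interval are determined by their value at `1` (`DCOUS.eq_smul_of_additive`). The action is therefore
unique and preserved by all predicate transformers, and the space constructed from an object of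
`DCEAc` carries the given action, which makes `DCOUS.interval` essentially surjective. -/

namespace EffTheory

/-! ### Partial commutative monoids and effect algebras. -/

section PCM

variable {M : Type v} [PCM M]

/-- With undefined sums as an absorbing element, Kleene equalities become equations in a commutative
monoid. Rearranging a defined sum then shows that its partial sums are defined. -/
instance : Zero (Option M) := ⟨some PCM.zero⟩

instance : Add (Option M) := ⟨fun a b => a.bind fun x => b.bind fun y => PCM.oplus x y⟩

/-- A partial commutative monoid with an absorbing element `none` adjoined is a commutative
monoid. -/
instance PCM.addCommMonoidOption : AddCommMonoid (Option M) where
  add_assoc a b c := by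
    rcases a with _ | x
    · rfl
    rcases b with _ | y
    · rfl
    rcases c with _ | z
    · change ((PCM.oplus x y).bind fun _ => none) = none
      cases PCM.oplus x y <;> rfl
    exact PCM.oplus_assoc x y z
  add_comm a b := by
    rcases a with _ | x <;> rcases b with _ | y
    · rfl
    · rfl
    · rfl
    · exact PCM.oplus_comm x y
  zero_add a := by
    rcases a with _ | x
    · rfl
    · exact PCM.zero_oplus x
  add_zero a := by
    rcases a with _ | x
    · rfl
    · exact (PCM.oplus_comm x _).trans (PCM.zero_oplus x)
  nsmul := nsmulRec

theorem oplus_eq_add (x y : M) : PCM.oplus x y = (some x + some y : Option M) := rfl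

theorem exists_some_of_add_eq_some {a b : Option M} {z : M} (h : a + b = some z) :
    ∃ x y, a = some x ∧ b = some y := by
  rcases a with _ | x
  · cases h
  rcases b with _ | y
  · cases h
  exact ⟨x, y, rfl, rfl⟩

theorem pLe_iff_exists {x y : M} : PLe x y ↔ ∃ c : Option M, some x + c = some y :=
  ⟨fun ⟨z, hz⟩ => ⟨some z, hz⟩, fun ⟨c, hc⟩ => by
    obtain ⟨_, z, _, rfl⟩ := exists_some_of_add_eq_some hc
    exact ⟨z, hc⟩⟩

theorem Perp.symm {x y : M} (h : Perp x y) : Perp y x := by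
  obtain ⟨z, hz⟩ := h
  exact ⟨z, (PCM.oplus_comm y x).trans hz⟩

theorem pLe_refl (x : M) : PLe x x := pLe_iff_exists.2 ⟨0, add_zero _⟩

theorem PLe.trans {x y z : M} (h : PLe x y) (h' : PLe y z) : PLe x z := by
  rw [pLe_iff_exists] at *
  obtain ⟨c, hc⟩ := h
  obtain ⟨d, hd⟩ := h'
  exact ⟨c + d, by rw [← add_assoc, hc, hd]⟩

/-- Sums of smaller elements exist and are smaller. -/
theorem PLe.oplus {x y x' y' z : M} (hx : PLe x x') (hy : PLe y y')
    (h : PCM.oplus x' y' = some z) : ∃ w, PCM.oplus x y = some w ∧ PLe w z := by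
  rw [pLe_iff_exists] at hx hy
  obtain ⟨c, hc⟩ := hx
  obtain ⟨d, hd⟩ := hy
  rw [oplus_eq_add, ← hc, ← hd, add_add_add_comm] at h
  obtain ⟨w, _, hw, _⟩ := exists_some_of_add_eq_some h
  exact ⟨w, hw, pLe_iff_exists.2 ⟨c + d, by rw [← hw, h]⟩⟩

theorem Perp.mono {x y x' y' : M} (h : Perp x' y') (hx : PLe x x') (hy : PLe y y') :
    Perp x y := by
  obtain ⟨z, hz⟩ := h
  obtain ⟨w, hw, _⟩ := hx.oplus hy hz
  exact ⟨w, hw⟩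

end PCM

section Additive

variable {M : Type v} {N : Type w} [PCM M] [PCM N] {f : M → N}

theorem IsAdditive.map_add (hf : IsAdditive f) {x y z : M}
    (h : (some x + some y : Option M) = some z) :
    (some (f x) + some (f y) : Option N) = some (f z) := hf.2 x y z h

theorem IsAdditive.pLe (hf : IsAdditive f) {x y : M} (h : PLe x y) : PLe (f x) (f y) := by
  obtain ⟨z, hz⟩ := h
  exact ⟨f z, hf.2 _ _ _ hz⟩

theorem IsAdditive.perp (hf : IsAdditive f) {x y : M} (h : Perp x y) : Perp (f x) (f y) := by
  obtain ⟨z, hz⟩ := h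
  exact ⟨f z, hf.2 _ _ _ hz⟩

end Additive

namespace IsEffectAlgebra

variable {M : Type v} [PCM M] {one : M}

theorem exists_ortho (h : IsEffectAlgebra one) (x : M) :
    ∃ y, (some x + some y : Option M) = some one := (h.existsUnique_ortho x).exists

theorem ortho_unique (h : IsEffectAlgebra one) {x y z : M}
    (hy : (some x + some y : Option M) = some one)
    (hz : (some x + some z : Option M) = some one) : y = z :=
  (h.existsUnique_ortho x).unique hy hz

theorem pLe_one (h : IsEffectAlgebra one) (x : M) : PLe x one := h.exists_ortho x

/-- If `w'` is the complement of `w`, then `x` and `y` are both the complement of `w' ⊕ z`. -/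
theorem add_right_cancel (h : IsEffectAlgebra one) {x y z w : M}
    (hx : (some x + some z : Option M) = some w) (hy : (some y + some z : Option M) = some w) :
    x = y := by
  obtain ⟨w', hw⟩ := h.exists_ortho w
  have hx' := hw
  have hy' := hw
  rw [← hx, add_assoc, add_comm] at hx'
  rw [← hy, add_assoc, add_comm] at hy'
  obtain ⟨t, _, ht, _⟩ := exists_some_of_add_eq_some hx'
  rw [ht] at hx' hy'
  exact h.ortho_unique hx' hy'

theorem add_left_cancel (h : IsEffectAlgebra one) {x y z w : M}
    (hx : (some z + some x : Option M) = some w) (hy : (some z + some y : Option M) = some w) :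
    x = y := by
  rw [add_comm] at hx hy
  exact h.add_right_cancel hx hy

theorem eq_zero_of_add_eq (h : IsEffectAlgebra one) {x y : M}
    (hxy : (some x + some y : Option M) = some x) : y = PCM.zero :=
  h.add_left_cancel hxy (add_zero _)

theorem eq_zero_of_add_eq_zero (h : IsEffectAlgebra one) {x y : M}
    (hxy : (some x + some y : Option M) = some PCM.zero) : x = PCM.zero := by
  have h1 : (some x + some y : Option M) + some one = some one := by
    rw [hxy]; exact zero_add _
  rw [add_comm (some x), add_assoc, add_comm] at h1
  obtain ⟨z, _, hz, _⟩ := exists_some_of_add_eq_some h1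
  exact h.eq_zero_of_perp_one x ⟨z, hz⟩

theorem eq_zero_of_pLe_zero (h : IsEffectAlgebra one) {x : M} (hx : PLe x PCM.zero) :
    x = PCM.zero := by
  obtain ⟨y, hy⟩ := hx
  exact h.eq_zero_of_add_eq_zero hy

theorem antisymm (h : IsEffectAlgebra one) {x y : M} (hxy : PLe x y) (hyx : PLe y x) : x = y := by
  obtain ⟨a, ha⟩ := hxy
  obtain ⟨b, hb⟩ := hyx
  rw [oplus_eq_add] at ha hb
  have h1 := hb
  rw [← ha, add_assoc] at h1
  obtain ⟨_, c, _, hc⟩ := exists_some_of_add_eq_some h1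
  rw [hc] at h1
  rw [h.eq_zero_of_add_eq h1] at hc
  rw [h.eq_zero_of_add_eq_zero hc] at ha
  exact Option.some.inj ((add_zero _).symm.trans ha)

/-- Elements are summable exactly when one is below the complement of the other. -/
theorem perp_iff_pLe (h : IsEffectAlgebra one) {x y y' : M}
    (hy : (some y + some y' : Option M) = some one) : Perp x y ↔ PLe x y' := by
  constructor
  · rintro ⟨z, hz⟩
    obtain ⟨z', hz'⟩ := h.exists_ortho z
    rw [← hz, oplus_eq_add, add_comm (some x), add_assoc] at hz'
    obtain ⟨_, c, _, hc⟩ := exists_some_of_add_eq_some hz'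
    rw [hc] at hz'
    rw [h.ortho_unique hz' hy] at hc
    exact ⟨z', hc⟩
  · intro hx
    have hy2 : PCM.oplus y' y = some one := by rw [oplus_eq_add, add_comm]; exact hy
    exact Perp.mono ⟨_, hy2⟩ hx (pLe_refl _)

end IsEffectAlgebra

/-- A halving of an effect algebra: an additive map that sends `x` to an element whose double
is `x`. -/
structure IsHalving {M : Type v} [PCM M] (hf : M → M) : Prop where
  additive : IsAdditive hf
  add_self : ∀ x, PCM.oplus (hf x) (hf x) = some x

/-! ### From an effect algebra with halving to a partially ordered group. -/

section DyadicCone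

variable {E : Type v} [PCM E] {one : E} {hf : E → E}

/-- Halves are unique because an additive halving commutes with doubling. -/
theorem IsHalving.eq_half (hh : IsHalving hf) {x y : E}
    (h : (some y + some y : Option E) = some x) : y = hf x := by
  have h1 := hh.additive.map_add h
  have h2 := hh.add_self y
  rw [oplus_eq_add, h1] at h2
  exact (Option.some.inj h2).symm

/-- Both halves lie below the half of the top, which is summable with itself. -/
theorem IsHalving.add_half (hE : IsEffectAlgebra one) (hh : IsHalving hf) (x y : E) :
    ∃ z, (some (hf x) + some (hf y) : Option E) = some z := by
  obtain ⟨z, hz, _⟩ := (hh.additive.pLe (hE.pLe_one x)).oplus (hh.additive.pLe (hE.pLe_one y))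
    (hh.add_self one)
  exact ⟨z, hz⟩

theorem IsHalving.succ_eq (hh : IsHalving hf) {f : ℕ → Option E}
    (hd : ∀ n, f n = f (n + 1) + f (n + 1)) {n : ℕ} {x : E} (hx : f n = some x) :
    f (n + 1) = some (hf x) := by
  have h1 := hd n
  rw [hx] at h1
  obtain ⟨y, _, hy, _⟩ := exists_some_of_add_eq_some h1.symm
  rw [hy] at h1 ⊢
  rw [hh.eq_half h1.symm]

theorem IsHalving.add_iterate_eq (hh : IsHalving hf)
    {f : ℕ → Option E} (hd : ∀ n, f n = f (n + 1) + f (n + 1)) {n : ℕ} {x : E}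
    (hx : f n = some x) (k : ℕ) : f (n + k) = some (hf^[k] x) := by
  induction k with
  | zero => exact hx
  | succ k ih => rw [Function.iterate_succ_apply']; exact hh.succ_eq hd ih

/-- The multiples `p` of the elements of an effect algebra with a halving, represented by the
sequence of the `p / 2 ^ n`, where `none` stands for an element that is not below the top. -/
def dyadicCone (hE : IsEffectAlgebra one) (hh : IsHalving hf) : AddSubmonoid (ℕ → Option E) where
  carrier := {f | (∀ n, f n = f (n + 1) + f (n + 1)) ∧ ∃ n x, f n = some x}
  zero_mem' := ⟨fun _ => (add_zero _).symm, 0, PCM.zero, rfl⟩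
  add_mem' := by
    rintro f g ⟨hf1, n, x, hx⟩ ⟨hg1, m, y, hy⟩
    -- Both sequences are defined from index `n + m` on; one more halving makes their terms
    -- summable.
    refine ⟨fun k => ?_, n + m + 1, ?_⟩
    · change f k + g k = f (k + 1) + g (k + 1) + (f (k + 1) + g (k + 1))
      rw [hf1 k, hg1 k, add_add_add_comm]
    · have h1 := hh.succ_eq hf1 (hh.add_iterate_eq hf1 hx m)
      have h2 := hh.succ_eq hg1 (hh.add_iterate_eq hg1 hy n)
      rw [add_comm m n] at h2
      change ∃ z, f (n + m + 1) + g (n + m + 1) = some z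
      rw [h1, h2]
      exact hh.add_half hE _ _

namespace dyadicCone

variable (hE : IsEffectAlgebra one) (hh : IsHalving hf)

/-- Each term is the double of the next, so a tail determines the whole sequence. -/
theorem eq_of_ge {f g : ℕ → Option E} (hf1 : ∀ n, f n = f (n + 1) + f (n + 1))
    (hg1 : ∀ n, g n = g (n + 1) + g (n + 1)) (n : ℕ) (h : ∀ m ≥ n, f m = g m) : f = g := by
  induction n with
  | zero => exact funext fun m => h m (Nat.zero_le m)
  | succ n ih =>
    refine ih fun m hm => ?_
    rcases hm.eq_or_lt with rfl | hm
    · rw [hf1, hg1, h _ le_rfl]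
    · exact h m hm

instance isCancelAdd : IsCancelAdd (dyadicCone hE hh) := by
  have : IsRightCancelAdd (dyadicCone hE hh) := ⟨by
    rintro ⟨h, hh1, k, z, hz⟩ ⟨f, hf1, n, x, hx⟩ ⟨g, hg1, m, y, hy⟩ he
    have he' : f + h = g + h := congrArg Subtype.val he
    -- From this index on, all three terms are halves of elements of `E`, so their sums are defined
    -- and cancellation in `E` applies.
    refine Subtype.ext (eq_of_ge hf1 hg1 (n + m + k + 1) fun i hi => ?_)
    obtain ⟨j, rfl⟩ := Nat.exists_eq_add_of_le hi
    have h1 := hh.succ_eq hf1 (hh.add_iterate_eq hf1 hx (m + k + j))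
    have h2 := hh.succ_eq hg1 (hh.add_iterate_eq hg1 hy (n + k + j))
    have h3 := hh.succ_eq hh1 (hh.add_iterate_eq hh1 hz (n + m + j))
    have he2 := congrFun he' (n + m + k + 1 + j)
    simp only [Pi.add_apply] at he2
    rw [show n + (m + k + j) + 1 = n + m + k + 1 + j by ring] at h1
    rw [show m + (n + k + j) + 1 = n + m + k + 1 + j by ring] at h2
    rw [show k + (n + m + j) + 1 = n + m + k + 1 + j by ring] at h3
    rw [h1, h2, h3] at he2
    obtain ⟨w, hw⟩ := hh.add_half hE (hf^[m + k + j] x) (hf^[n + m + j] z)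
    exact h1.trans ((congrArg some (hE.add_right_cancel hw (he2 ▸ hw))).trans h2.symm)⟩
  exact AddCommMagma.IsRightCancelAdd.toIsCancelAdd _

/-- The half of an element of the cone. -/
def half (p : dyadicCone hE hh) : dyadicCone hE hh :=
  ⟨fun n => p.1 (n + 1), fun n => p.2.1 (n + 1), by
    obtain ⟨n, x, hx⟩ := p.2.2
    exact ⟨n, _, hh.succ_eq p.2.1 hx⟩⟩

theorem half_add_half (p : dyadicCone hE hh) : half hE hh p + half hE hh p = p :=
  Subtype.ext (funext fun n => (p.2.1 n).symm)

theorem half_add (p q : dyadicCone hE hh) :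
    half hE hh (p + q) = half hE hh p + half hE hh q := rfl

/-- The embedding of an effect algebra in its cone. -/
def incl (x : E) : dyadicCone hE hh :=
  ⟨fun n => some (hf^[n] x), fun n => by
    change some (hf^[n] x) = some (hf^[n + 1] x) + some (hf^[n + 1] x)
    rw [Function.iterate_succ_apply']; exact (hh.add_self _).symm, 0, x, rfl⟩

theorem incl_injective {x y : E} (h : incl hE hh x = incl hE hh y) : x = y :=
  Option.some.inj (congrFun (congrArg Subtype.val h) 0)

theorem eq_incl {p : dyadicCone hE hh} {x : E} (hx : p.1 0 = some x) : p = incl hE hh x := by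
  refine Subtype.ext (funext fun n => ?_)
  have := hh.add_iterate_eq p.2.1 hx n
  rwa [zero_add] at this

theorem exists_eq_nsmul_incl (n : ℕ) (p : dyadicCone hE hh) (x : E) (hx : p.1 n = some x) :
    p = 2 ^ n • incl hE hh x := by
  induction n generalizing p with
  | zero => rw [pow_zero, one_nsmul]; exact eq_incl hE hh hx
  | succ n ih =>
    rw [← half_add_half hE hh p, ih (half hE hh p) hx, ← two_nsmul, ← mul_nsmul', pow_succ']

theorem incl_add_iff {x y z : E} :
    PCM.oplus x y = some z ↔ incl hE hh x + incl hE hh y = incl hE hh z := by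
  constructor
  · intro h
    exact eq_incl hE hh (p := incl hE hh x + incl hE hh y) h
  · intro h
    exact congrFun (congrArg Subtype.val h) 0

theorem eq_zero_of_add_eq_zero {p q : dyadicCone hE hh} (h : p + q = 0) : p = 0 := by
  have h0 : p.1 0 + q.1 0 = some PCM.zero := congrFun (congrArg Subtype.val h) 0
  obtain ⟨x, y, hx, hy⟩ := exists_some_of_add_eq_some h0
  rw [hx, hy] at h0
  rw [hE.eq_zero_of_add_eq_zero h0] at hx
  rw [eq_incl hE hh hx]
  exact (eq_incl hE hh (p := 0) rfl).symm

end dyadicCone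

/-- `ι` identifies the effect algebra `E` with the unit interval below `ι one` in a partially
ordered abelian group in which division by two is possible. -/
structure IsUnitInterval {E : Type v} [PCM E] (one : E) {G : Type w} [AddCommGroup G]
    [PartialOrder G] (ι : E → G) : Prop where
  add_iff : ∀ {x y z : E}, PCM.oplus x y = some z ↔ ι x + ι y = ι z
  mem_range : ∀ g : G, (0 ≤ g ∧ g ≤ ι one) ↔ ∃ x, ι x = g
  injective : Function.Injective ι
  exists_half : ∀ g : G, ∃ h, h + h = g
  nonneg_of_double : ∀ g : G, 0 ≤ g + g → 0 ≤ g
  exists_pow : ∀ g : G, ∃ n : ℕ, g ≤ 2 ^ n • ι one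

-- The group is the Grothendieck group of the dyadic cone. Cancellativity embeds the cone in it, and
-- the absence of nonzero invertible elements makes the order given by the cone antisymmetric.
open Algebra in
theorem exists_isUnitInterval (hE : IsEffectAlgebra one) (hh : IsHalving hf) : ∃ (G : Type v) (_ : AddCommGroup G) (_ : PartialOrder G)
    (_ : IsOrderedAddMonoid G) (ι : E → G), IsUnitInterval one ι := by
  let P := dyadicCone hE hh
  let G := GrothendieckAddGroup P
  let of : P →+ G := GrothendieckAddGroup.of
  have of_inj : Function.Injective of := GrothendieckAddGroup.of_injective
  have of_surj : ∀ g : G, ∃ p q, g = of p - of q := by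
    intro g
    obtain ⟨⟨p, q⟩, h⟩ := (AddLocalization.addMonoidOf (⊤ : AddSubmonoid P)).surj g
    exact ⟨p, q, eq_sub_of_add_eq h⟩
  let cone : AddGroupCone G :=
    { AddMonoidHom.mrange of with
      eq_zero_of_mem_of_neg_mem' := by
        rintro _ ⟨p, rfl⟩ ⟨q, hq⟩
        have : of (p + q) = of 0 := by rw [map_add, hq, map_zero, add_neg_cancel]
        rw [dyadicCone.eq_zero_of_add_eq_zero hE hh (of_inj this), map_zero] }
  let po : PartialOrder G := PartialOrder.mkOfAddGroupCone cone
  have oam : IsOrderedAddMonoid G := IsOrderedAddMonoid.mkOfCone cone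
  have le_iff : ∀ a b : G, a ≤ b ↔ ∃ p, of p = b - a := fun a b => Iff.rfl
  have nonneg_iff : ∀ a : G, 0 ≤ a ↔ ∃ p, of p = a := fun a => by rw [le_iff, sub_zero]
  have incl_le : ∀ x : E, of (dyadicCone.incl hE hh x) ≤ of (dyadicCone.incl hE hh one) := by
    intro x
    obtain ⟨y, hy⟩ := hE.exists_ortho x
    refine (le_iff _ _).2 ⟨dyadicCone.incl hE hh y, ?_⟩
    rw [← (dyadicCone.incl_add_iff hE hh).1 hy, map_add, add_sub_cancel_left]
  -- Halving is a well-defined additive operation on the cone, so doubles there determine their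
  -- halves.
  have torsion : ∀ a : G, a + a = 0 → a = 0 := by
    intro a ha
    obtain ⟨p, q, rfl⟩ := of_surj a
    have h1 : of (p + p) = of (q + q) := by
      rw [map_add, map_add, ← sub_eq_zero, ← ha]; abel
    have h2 := congrArg (dyadicCone.half hE hh) (of_inj h1)
    rw [dyadicCone.half_add, dyadicCone.half_add, dyadicCone.half_add_half,
      dyadicCone.half_add_half] at h2
    rw [h2, sub_self]
  refine ⟨G, inferInstance, po, oam, fun x => of (dyadicCone.incl hE hh x), ?_, ?_, ?_, ?_, ?_, ?_⟩
  · intro x y z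
    rw [dyadicCone.incl_add_iff hE hh, ← map_add, of_inj.eq_iff]
  · intro g
    constructor
    · rintro ⟨h0, h1⟩
      obtain ⟨p, rfl⟩ := (nonneg_iff _).1 h0
      obtain ⟨q, hq⟩ := (le_iff _ _).1 h1
      have hq' : p + q = dyadicCone.incl hE hh one := of_inj (by rw [map_add, hq]; abel)
      -- A sum that is defined at index `0` has summands defined at index `0`, and these come from
      -- `E`.
      have h3 : p.1 0 + q.1 0 = some one := congrFun (congrArg Subtype.val hq') 0
      obtain ⟨x, _, hx, _⟩ := exists_some_of_add_eq_some h3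
      exact ⟨x, by rw [dyadicCone.eq_incl hE hh hx]⟩
    · rintro ⟨x, rfl⟩
      exact ⟨(nonneg_iff _).2 ⟨_, rfl⟩, incl_le x⟩
  · exact fun x y h => dyadicCone.incl_injective hE hh (of_inj h)
  · intro g
    obtain ⟨p, q, rfl⟩ := of_surj g
    refine ⟨of (dyadicCone.half hE hh p) - of (dyadicCone.half hE hh q), ?_⟩
    rw [sub_add_sub_comm, ← map_add, ← map_add, dyadicCone.half_add_half,
      dyadicCone.half_add_half]
  · intro g hg
    obtain ⟨p, hp⟩ := (nonneg_iff _).1 hg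
    refine (nonneg_iff _).2 ⟨dyadicCone.half hE hh p, ?_⟩
    rw [← sub_eq_zero]
    apply torsion
    rw [sub_add_sub_comm, ← map_add, dyadicCone.half_add_half, hp, sub_self]
  · intro g
    obtain ⟨p, q, rfl⟩ := of_surj g
    obtain ⟨n, x, hx⟩ := p.2.2
    refine ⟨n, ?_⟩
    have h1 : of p - of q ≤ of p := sub_le_self _ ((nonneg_iff _).2 ⟨q, rfl⟩)
    refine h1.trans ?_
    rw [dyadicCone.exists_eq_nsmul_incl hE hh n p x hx, map_nsmul]
    exact nsmul_le_nsmul_right (incl_le x) _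

end DyadicCone

/-! ### Monotone complete divisible groups and their real scalar multiplication. -/

/-- A partially ordered abelian group with order unit `e` in which division by two is possible and
bounded directed subsets have suprema. -/
structure IsDivisibleMonotoneComplete {G : Type w} [AddCommGroup G] [PartialOrder G] (e : G) :
    Prop where
  unit_nonneg : 0 ≤ e
  exists_half : ∀ g : G, ∃ h, h + h = g
  nonneg_of_double : ∀ g : G, 0 ≤ g + g → 0 ≤ g
  exists_pow : ∀ g : G, ∃ n : ℕ, g ≤ 2 ^ n • e
  exists_isLUB : ∀ S : Set G, S.Nonempty → DirectedOn (· ≤ ·) S → BddAbove S → ∃ z, IsLUB S z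

theorem nonneg_of_pow_nsmul_nonneg {G : Type w} [AddCommGroup G] [PartialOrder G]
    (hd : ∀ g : G, 0 ≤ g + g → 0 ≤ g) (n : ℕ) {g : G} (hg : 0 ≤ 2 ^ n • g) : 0 ≤ g := by
  induction n with
  | zero => simpa using hg
  | succ n ih =>
    refine ih (hd _ ?_)
    rwa [← two_nsmul, ← mul_nsmul', ← pow_succ']

theorem le_of_pow_nsmul_le {G : Type w} [AddCommGroup G] [PartialOrder G] [IsOrderedAddMonoid G]
    (hd : ∀ g : G, 0 ≤ g + g → 0 ≤ g) (n : ℕ) {a b : G} (hab : 2 ^ n • a ≤ 2 ^ n • b) :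
    a ≤ b := by
  rw [← sub_nonneg] at hab ⊢
  rw [← nsmul_sub] at hab
  exact nonneg_of_pow_nsmul_nonneg hd n hab

namespace IsUnitInterval

variable {E : Type v} [PCM E] {one : E} {G : Type w} [AddCommGroup G] [PartialOrder G]
  {ι : E → G}

theorem map_nonneg (h : IsUnitInterval one ι) (x : E) : 0 ≤ ι x := ((h.mem_range _).2 ⟨x, rfl⟩).1

theorem map_le_one (h : IsUnitInterval one ι) (x : E) : ι x ≤ ι one :=
  ((h.mem_range _).2 ⟨x, rfl⟩).2

theorem exists_pow_nsmul_eq (h : IsUnitInterval one ι) (n : ℕ) (g : G) :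
    ∃ a, 2 ^ n • a = g := by
  induction n generalizing g with
  | zero => exact ⟨g, by simp⟩
  | succ n ih =>
    obtain ⟨b, rfl⟩ := h.exists_half g
    obtain ⟨a, rfl⟩ := ih b
    exact ⟨a, by rw [pow_succ', mul_nsmul', two_nsmul]⟩

variable [IsOrderedAddMonoid G]

theorem le_iff (h : IsUnitInterval one ι) {x y : E} : ι x ≤ ι y ↔ PLe x y := by
  constructor
  · intro hxy
    obtain ⟨z, hz⟩ := (h.mem_range (ι y - ι x)).1
      ⟨sub_nonneg.2 hxy, (sub_le_self _ (h.map_nonneg x)).trans (h.map_le_one y)⟩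
    exact ⟨z, h.add_iff.2 (by rw [hz]; abel)⟩
  · rintro ⟨z, hz⟩
    rw [← h.add_iff.1 hz]
    exact le_add_of_nonneg_right (h.map_nonneg z)

theorem exists_scaled (h : IsUnitInterval one ι) (n : ℕ) {g : G} (h0 : 0 ≤ g)
    (h1 : g ≤ 2 ^ n • ι one) : ∃ x, g = 2 ^ n • ι x := by
  obtain ⟨a, rfl⟩ := h.exists_pow_nsmul_eq n g
  have h1' : a ≤ ι one := le_of_pow_nsmul_le h.nonneg_of_double n h1
  obtain ⟨x, rfl⟩ := (h.mem_range a).1 ⟨nonneg_of_pow_nsmul_nonneg h.nonneg_of_double n h0, h1'⟩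
  exact ⟨x, rfl⟩

theorem pow_nsmul_le (h : IsUnitInterval one ι) (n : ℕ) {a b : G} :
    2 ^ n • a ≤ 2 ^ n • b ↔ a ≤ b := by
  constructor
  · exact le_of_pow_nsmul_le h.nonneg_of_double n
  · exact fun hab => nsmul_le_nsmul_right hab _

/-- Directed sets in a multiple of the unit interval have suprema relative to it. -/
theorem exists_relative_sup (h : IsUnitInterval one ι) (hdc : IsDirectedComplete (PLe (M := E)))
    (n : ℕ) {S : Set G} (hd : DirectedOn (· ≤ ·) S)
    (hS : ∀ g ∈ S, 0 ≤ g ∧ g ≤ 2 ^ n • ι one) :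
    ∃ z ≤ 2 ^ n • ι one, (∀ g ∈ S, g ≤ z) ∧
      ∀ b, 0 ≤ b → b ≤ 2 ^ n • ι one → (∀ g ∈ S, g ≤ b) → z ≤ b := by
  obtain ⟨s, hs1, hs2⟩ := hdc {x | 2 ^ n • ι x ∈ S} (by
    intro x hx y hy
    obtain ⟨g, hg, hxg, hyg⟩ := hd _ hx _ hy
    obtain ⟨z, rfl⟩ := h.exists_scaled n (hS g hg).1 (hS g hg).2
    exact ⟨z, hg, h.le_iff.1 ((h.pow_nsmul_le n).1 hxg), h.le_iff.1 ((h.pow_nsmul_le n).1 hyg)⟩)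
  refine ⟨2 ^ n • ι s, nsmul_le_nsmul_right (h.map_le_one s) _, fun g hg => ?_,
    fun b hb0 hb1 hb => ?_⟩
  · obtain ⟨z, rfl⟩ := h.exists_scaled n (hS g hg).1 (hS g hg).2
    exact (h.pow_nsmul_le n).2 (h.le_iff.2 (hs1 z hg))
  · obtain ⟨y, rfl⟩ := h.exists_scaled n hb0 hb1
    exact (h.pow_nsmul_le n).2 (h.le_iff.2 (hs2 y fun x hx =>
      h.le_iff.1 ((h.pow_nsmul_le n).1 (hb _ hx))))

/-- An upper bound `c` may lie outside the interval in which the supremum `z` was formed. The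
supremum `z'` relative to a larger interval containing `c` satisfies `z' ≤ z`, so it lies in the
smaller interval too; thus `z ≤ z' ≤ c`. -/
theorem exists_isLUB_of_nonneg (h : IsUnitInterval one ι)
    (hdc : IsDirectedComplete (PLe (M := E))) {S : Set G} (hne : S.Nonempty)
    (hd : DirectedOn (· ≤ ·) S) (hS : ∀ g ∈ S, 0 ≤ g) (hb : BddAbove S) : ∃ z, IsLUB S z := by
  obtain ⟨b, hb⟩ := hb
  obtain ⟨g0, hg0⟩ := hne
  obtain ⟨n, hn⟩ := h.exists_pow b
  have mono : ∀ {n m : ℕ}, n ≤ m → 2 ^ n • ι one ≤ 2 ^ m • ι one := fun hnm =>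
    nsmul_le_nsmul_left (h.map_nonneg one) (Nat.pow_le_pow_right (by norm_num) hnm)
  obtain ⟨z, hz, hz1, hz2⟩ := h.exists_relative_sup hdc n hd
    fun g hg => ⟨hS g hg, (hb hg).trans hn⟩
  refine ⟨z, hz1, fun c hc => ?_⟩
  obtain ⟨m, hm⟩ := h.exists_pow c
  obtain ⟨z', hz', hz1', hz2'⟩ := h.exists_relative_sup hdc (n + m) hd
    fun g hg => ⟨hS g hg, (hb hg).trans (hn.trans (mono (Nat.le_add_right n m)))⟩
  have hz0 := (hS g0 hg0).trans (hz1 g0 hg0)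
  have hz0' := (hS g0 hg0).trans (hz1' g0 hg0)
  have h1 : z' ≤ z := hz2' z hz0 (hz.trans (mono (Nat.le_add_right n m))) hz1
  exact (hz2 z' hz0' (h1.trans hz) hz1').trans
    (hz2' c ((hS g0 hg0).trans (hc hg0)) (hm.trans (mono (Nat.le_add_left m n))) hc)

theorem isDivisibleMonotoneComplete (h : IsUnitInterval one ι)
    (hdc : IsDirectedComplete (PLe (M := E))) : IsDivisibleMonotoneComplete (ι one) where
  unit_nonneg := h.map_nonneg one
  exists_half := h.exists_half
  nonneg_of_double := h.nonneg_of_double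
  exists_pow := h.exists_pow
  exists_isLUB S hne hd hb := by
    obtain ⟨s0, hs0⟩ := hne
    obtain ⟨b, hb⟩ := hb
    -- By directedness the elements above `s0` are cofinal in `S`; translating them by `-s0` makes
    -- them positive.
    obtain ⟨z, hz1, hz2⟩ := h.exists_isLUB_of_nonneg hdc (S := {g | g + s0 ∈ S ∧ 0 ≤ g})
      ⟨0, by simpa using hs0⟩ (by
        rintro x ⟨hx, hx0⟩ y ⟨hy, hy0⟩
        obtain ⟨t, ht, hxt, hyt⟩ := hd _ hx _ hy
        have h1 : x ≤ t - s0 := le_sub_iff_add_le.2 hxt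
        exact ⟨t - s0, ⟨by simpa using ht, hx0.trans h1⟩, h1, le_sub_iff_add_le.2 hyt⟩)
      (fun g hg => hg.2) ⟨b - s0, fun g hg => le_sub_iff_add_le.2 (hb hg.1)⟩
    refine ⟨z + s0, fun s hs => ?_, fun c hc => ?_⟩
    · obtain ⟨t, ht, hst, hs0t⟩ := hd _ hs _ hs0
      have : t - s0 ≤ z := hz1 ⟨by simpa using ht, sub_nonneg.2 hs0t⟩
      exact hst.trans (sub_le_iff_le_add.1 this)
    · rw [← le_sub_iff_add_le]
      exact hz2 fun g hg => le_sub_iff_add_le.2 (hc hg.1)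

end IsUnitInterval

namespace IsDivisibleMonotoneComplete

variable {G : Type w} [AddCommGroup G] [PartialOrder G] {e : G}

theorem exists_dyadic_fractions (h : IsDivisibleMonotoneComplete e) (g : G) :
    ∃ a : ℕ → G, a 0 = g ∧ (∀ n, a (n + 1) + a (n + 1) = a n) ∧ ∀ n, 2 ^ n • a n = g := by
  choose half hhalf using h.exists_half
  have h1 : ∀ n, half^[n + 1] g + half^[n + 1] g = half^[n] g := fun n => by
    rw [Function.iterate_succ_apply', hhalf]
  refine ⟨fun n => half^[n] g, rfl, h1, fun n => ?_⟩
  induction n with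
  | zero => exact one_nsmul _
  | succ n ih => 
    refine Eq.trans ?_ ih
    change 2 ^ (n + 1) • half^[n + 1] g = 2 ^ n • half^[n] g
    rw [← h1 n, pow_succ, mul_nsmul', two_nsmul]

/-- Additive maps from the reals that are bounded on bounded sets. -/
def IsLocallyBounded (f : ℝ →+ G) : Prop := ∀ c : ℝ, ∃ y, ∀ r, |r| ≤ c → f r ≤ y

theorem IsLocallyBounded.of_monotone {f : ℝ →+ G} (hf : Monotone f) : IsLocallyBounded f :=
  fun c => ⟨f c, fun _ hr => hf ((le_abs_self _).trans hr)⟩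

/-- The one-sided bound suffices because the condition `|r| ≤ c` is symmetric. -/
theorem IsLocallyBounded.neg {f : ℝ →+ G} (hf : IsLocallyBounded f) :
    IsLocallyBounded (-f) := fun c => by
  obtain ⟨y, hy⟩ := hf c
  exact ⟨y, fun r hr => by
    rw [AddMonoidHom.neg_apply, ← map_neg]; exact hy _ (by rwa [abs_neg])⟩

theorem IsLocallyBounded.comp_mulRight {f : ℝ →+ G} (hf : IsLocallyBounded f) (s : ℝ) :
    IsLocallyBounded (f.comp (AddMonoidHom.mulRight s)) := fun c => by
  obtain ⟨y, hy⟩ := hf (c * |s|)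
  exact ⟨y, fun r hr => hy _ (by
    rw [AddMonoidHom.coe_mulRight, abs_mul]
    exact mul_le_mul_of_nonneg_right hr (abs_nonneg s))⟩

variable [IsOrderedAddMonoid G]

theorem IsLocallyBounded.add {f g : ℝ →+ G} (hf : IsLocallyBounded f) (hg : IsLocallyBounded g) :
    IsLocallyBounded (f + g) := fun c => by
  obtain ⟨y, hy⟩ := hf c
  obtain ⟨z, hz⟩ := hg c
  exact ⟨y + z, fun r hr => add_le_add (hy r hr) (hz r hr)⟩

/-- The Archimedean property. If `a ≥ 0` has bounded multiples with supremum `z`, then `z ≤ z - a`,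
so `a ≤ 0`. A general `x` is below every dyadic fraction `c n` of a multiple of the unit; the
supremum `b` of the `x - c n` is at most `0`, and the first case applies to `x - b ≥ 0`. -/
theorem le_zero_of_pow_nsmul_le (h : IsDivisibleMonotoneComplete e) {x y : G}
    (hx : ∀ n : ℕ, 2 ^ n • x ≤ y) : x ≤ 0 := by
  have weak : ∀ a b : G, 0 ≤ a → (∀ n : ℕ, n • a ≤ b) → a ≤ 0 := by
    intro a b ha hab
    obtain ⟨z, hz1, hz2⟩ := h.exists_isLUB (Set.range fun n : ℕ => n • a) ⟨_, 0, rfl⟩ (by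
      rintro _ ⟨n, rfl⟩ _ ⟨m, rfl⟩
      exact ⟨_, ⟨n + m, rfl⟩, nsmul_le_nsmul_left ha (Nat.le_add_right n m),
        nsmul_le_nsmul_left ha (Nat.le_add_left m n)⟩)
      ⟨b, by rintro _ ⟨n, rfl⟩; exact hab n⟩
    have : z ≤ z - a := hz2 (by
      rintro _ ⟨n, rfl⟩
      rw [le_sub_iff_add_le, ← succ_nsmul]
      exact hz1 ⟨n + 1, rfl⟩)
    simpa using this
  obtain ⟨k, hk⟩ := h.exists_pow y
  obtain ⟨c, hc0, hc, hcp⟩ := h.exists_dyadic_fractions (2 ^ k • e)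
  have hc_nonneg : ∀ n, 0 ≤ c n := fun n =>
    nonneg_of_pow_nsmul_nonneg h.nonneg_of_double n (by rw [hcp]; exact nsmul_nonneg h.unit_nonneg _)
  have hxc : ∀ n, x ≤ c n := fun n => le_of_pow_nsmul_le h.nonneg_of_double n (by rw [hcp]; exact (hx n).trans hk)
  have anti : Antitone c := antitone_nat_of_succ_le fun n => by
    rw [← hc n]; exact le_add_of_nonneg_right (hc_nonneg _)
  obtain ⟨b, hb1, hb2⟩ := h.exists_isLUB (Set.range fun n : ℕ => x - c n) ⟨_, 0, rfl⟩ (by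
      rintro _ ⟨n, rfl⟩ _ ⟨m, rfl⟩
      exact ⟨_, ⟨n + m, rfl⟩, sub_le_sub_left (anti (Nat.le_add_right n m)) _,
        sub_le_sub_left (anti (Nat.le_add_left m n)) _⟩)
      ⟨0, by rintro _ ⟨n, rfl⟩; exact sub_nonpos.2 (hxc n)⟩
  have hb0 : b ≤ 0 := hb2 (by rintro _ ⟨n, rfl⟩; exact sub_nonpos.2 (hxc n))
  have hbx : b ≤ x := hb2 (by rintro _ ⟨n, rfl⟩; exact sub_le_self _ (hc_nonneg n))
  have := weak (x - b) (2 ^ k • e) (sub_nonneg.2 hbx) fun n => by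
    refine (nsmul_le_nsmul_left (sub_nonneg.2 hbx) (Nat.lt_two_pow_self (n := n)).le).trans ?_
    rw [← hcp n]
    refine nsmul_le_nsmul_right ?_ _
    rw [sub_le_comm]
    exact hb1 ⟨n, rfl⟩
  exact (sub_nonpos.1 this).trans hb0

theorem le_zero_of_nsmul_le (h : IsDivisibleMonotoneComplete e) {x y : G}
    (hx : ∀ n : ℕ, n • x ≤ y) : x ≤ 0 := h.le_zero_of_pow_nsmul_le fun _ => hx _

open Pointwise in
/-- For a positive element `g` there is a monotone additive map from the reals that sends `1` to
`g`. -/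
theorem exists_monotone_addMonoidHom (h : IsDivisibleMonotoneComplete e) {g : G} (hg : 0 ≤ g) :
    ∃ f : ℝ →+ G, f 1 = g ∧ Monotone f := by
  obtain ⟨a, ha0, ha, hap⟩ := h.exists_dyadic_fractions g
  have ha_nonneg : ∀ n, 0 ≤ a n := fun n => nonneg_of_pow_nsmul_nonneg h.nonneg_of_double n (by rwa [hap])
  have shift : ∀ (m n : ℕ), (2 ^ m : ℕ) • a (n + m) = a n := by
    intro m n
    induction m with
    | zero => exact one_nsmul _
    | succ m ih => rw [pow_succ', mul_nsmul, two_nsmul, ← add_assoc, ha, ih]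
  have zshift : ∀ (k : ℤ) (m n : ℕ), (k * 2 ^ m) • a (n + m) = k • a n := by
    intro k m n
    rw [mul_zsmul', ← shift m n, ← natCast_zsmul]
    push_cast
    rw [← mul_zsmul', ← mul_zsmul', mul_comm]
  -- The value at `l` will be the supremum of the dyadic multiples of `g` with coefficient below
  -- `l`. Strictness of the inequality gives `S l + S m = S (l + m)`, hence additivity.
  let S : ℝ → Set G := fun l => {x | ∃ (k : ℤ) (n : ℕ), (k : ℝ) < l * 2 ^ n ∧ k • a n = x}
  have hne : ∀ l, (S l).Nonempty := fun l => by
    obtain ⟨k, hk⟩ := exists_int_lt l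
    exact ⟨_, k, 0, by simpa using hk, rfl⟩
  have hdir : ∀ l, DirectedOn (· ≤ ·) (S l) := by
    rintro l _ ⟨k, n, hk, rfl⟩ _ ⟨j, m, hj, rfl⟩
    have hp : ∀ n, (0 : ℝ) < 2 ^ n := fun n => by positivity
    have hkm : ((k * 2 ^ m : ℤ) : ℝ) < l * 2 ^ (n + m) := by
      push_cast
      rw [pow_add, ← mul_assoc]
      exact mul_lt_mul_of_pos_right hk (hp m)
    have hjn : ((j * 2 ^ n : ℤ) : ℝ) < l * 2 ^ (n + m) := by
      push_cast
      rw [add_comm, pow_add, ← mul_assoc]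
      exact mul_lt_mul_of_pos_right hj (hp n)
    refine ⟨max (k * 2 ^ m) (j * 2 ^ n) • a (n + m), ⟨_, _, ?_, rfl⟩, ?_, ?_⟩
    · rcases max_choice (k * 2 ^ m) (j * 2 ^ n) with h | h <;> rw [h] <;> assumption
    · rw [← zshift k m n]
      exact zsmul_le_zsmul_left (ha_nonneg _) (le_max_left _ _)
    · rw [← zshift j n m, add_comm m n]
      exact zsmul_le_zsmul_left (ha_nonneg _) (le_max_right _ _)
  have hbdd : ∀ l, BddAbove (S l) := fun l => by
    obtain ⟨K, hK⟩ := exists_int_gt l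
    refine ⟨K • g, ?_⟩
    rintro _ ⟨k, n, hk, rfl⟩
    rw [← ha0, ← zshift K n 0, zero_add]
    refine zsmul_le_zsmul_left (ha_nonneg _) ?_
    have : (k : ℝ) < K * 2 ^ n := hk.trans (mul_lt_mul_of_pos_right hK (by positivity))
    exact_mod_cast this.le
  choose F hF using fun l => h.exists_isLUB (S l) (hne l) (hdir l) (hbdd l)
  have hadd : ∀ l m, F (l + m) = F l + F m := by
    intro l m
    have hS : S l + S m = S (l + m) := by
      ext x
      constructor
      · rintro ⟨_, ⟨k, n, hk, rfl⟩, _, ⟨j, i, hj, rfl⟩, rfl⟩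
        refine ⟨k * 2 ^ i + j * 2 ^ n, n + i, ?_, ?_⟩
        · have h1 := mul_lt_mul_of_pos_right hk (show (0 : ℝ) < 2 ^ i by positivity)
          have h2 := mul_lt_mul_of_pos_right hj (show (0 : ℝ) < 2 ^ n by positivity)
          push_cast
          rw [pow_add]
          linarith
        · rw [add_zsmul, zshift, add_comm n i, zshift]
      · rintro ⟨k, n, hk, rfl⟩
        have hp : (0 : ℝ) < 2 ^ n := by positivity
        have h1 : (k : ℝ) / 2 ^ n - m < l := by
          rw [sub_lt_iff_lt_add, div_lt_iff₀ hp]; exact hk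
        -- Scaling by this `2 ^ i` makes the gap longer than `1`.
        obtain ⟨i, hi⟩ := pow_unbounded_of_one_lt (1 / (l - ((k : ℝ) / 2 ^ n - m)))
          (one_lt_two : (1 : ℝ) < 2)
        have hi0 : (0 : ℝ) < 2 ^ i := by positivity
        rw [div_lt_iff₀ (sub_pos.2 h1)] at hi
        -- an integer strictly between the endpoints scaled by `2 ^ i`
        obtain ⟨j, hj1, hj2⟩ : ∃ j : ℤ, ((k : ℝ) / 2 ^ n - m) * 2 ^ i < j ∧ (j : ℝ) < l * 2 ^ i := by
          refine ⟨⌊((k : ℝ) / 2 ^ n - m) * 2 ^ i⌋ + 1, ?_, ?_⟩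
          · push_cast; exact Int.lt_floor_add_one _
          · push_cast
            have := Int.floor_le (((k : ℝ) / 2 ^ n - m) * 2 ^ i)
            linarith
        refine Set.mem_add.2 ⟨j • a i, ⟨j, i, hj2, rfl⟩, (k * 2 ^ i - j * 2 ^ n) • a (n + i),
          ⟨_, _, ?_, rfl⟩, ?_⟩
        · push_cast
          have h3 : (k : ℝ) / 2 ^ n * 2 ^ n = k := div_mul_cancel₀ _ hp.ne'
          have h2 := mul_lt_mul_of_pos_right hj1 hp
          have h4 : ((k : ℝ) / 2 ^ n - m) * 2 ^ i * 2 ^ n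
            = (k : ℝ) * 2 ^ i - m * 2 ^ (n + i) := by
            rw [pow_add]; linear_combination (2 : ℝ) ^ i * h3
          linarith
        · rw [sub_zsmul, zshift, add_comm n i, zshift]
          abel
    exact (hF (l + m)).unique (hS ▸ (hF l).add (hF m))
  have hmono : Monotone F := fun l m hlm => (hF l).2 (by
    rintro _ ⟨k, n, hk, rfl⟩
    exact (hF m).1 ⟨k, n, hk.trans_le (mul_le_mul_of_nonneg_right hlm (by positivity)), rfl⟩)
  refine ⟨AddMonoidHom.mk' F hadd, (hF 1).unique ⟨?_, fun b hb => ?_⟩, hmono⟩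
  · rintro _ ⟨k, n, hk, rfl⟩
    rw [← hap n, ← natCast_zsmul]
    refine zsmul_le_zsmul_left (ha_nonneg _) ?_
    rw [one_mul] at hk
    exact_mod_cast hk.le
  -- An upper bound `b` dominates `(2 ^ n - 1) • a n = g - a n` for every `n`, so `2 ^ n • (g - b) ≤
  -- g` and the Archimedean property applies.
  · rw [← sub_nonpos]
    refine h.le_zero_of_pow_nsmul_le (y := g) fun n => ?_
    rw [← hap n]
    refine nsmul_le_nsmul_right ?_ _
    have h1 : ((2 : ℤ) ^ n - 1) • a n ≤ b := hb ⟨2 ^ n - 1, n, by push_cast; linarith, rfl⟩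
    have h2 : ((2 : ℤ) ^ n) • a n = 2 ^ n • a n := by
      rw [← natCast_zsmul]; push_cast; rfl
    rw [sub_zsmul, one_zsmul, h2, ← sub_eq_add_neg] at h1
    rwa [sub_le_comm]

/-- Writing `n * r` as its floor plus a fractional part bounds `n • f r` below independently of `n`;
the Archimedean property concludes. -/
theorem map_nonneg (h : IsDivisibleMonotoneComplete e) {f : ℝ →+ G} (hf : IsLocallyBounded f)
    (h1 : 0 ≤ f 1) {r : ℝ} (hr : 0 ≤ r) : 0 ≤ f r := by
  obtain ⟨y, hy⟩ := hf.neg 1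
  rw [← neg_nonpos]
  refine h.le_zero_of_nsmul_le (y := y) fun n => ?_
  have h2 : n • f r = ⌊n * r⌋₊ • f 1 + f (Int.fract (n * r)) := by
    rw [← map_nsmul, ← map_nsmul, ← map_add]
    congr 1
    have := natCast_floor_eq_intCast_floor (a := (n : ℝ) * r) (by positivity)
    rw [nsmul_eq_mul, nsmul_eq_mul, mul_one, this, Int.floor_add_fract]
  rw [smul_neg, h2, neg_add]
  refine (add_le_of_nonpos_left (neg_nonpos.2 (nsmul_nonneg h1 _))).trans (hy _ ?_)
  rw [abs_of_nonneg (Int.fract_nonneg _)]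
  exact (Int.fract_lt_one _).le

/-- Positivity applies to both `f - g` and `g - f`. This uniqueness is the source of the module
axioms. -/
theorem eq_of_map_one_eq (h : IsDivisibleMonotoneComplete e) {f g : ℝ →+ G}
    (hf : IsLocallyBounded f) (hg : IsLocallyBounded g) (h1 : f 1 = g 1) : f = g := by
  have key : ∀ r : ℝ, 0 ≤ r → f r = g r := by
    intro r hr
    have e1 := h.map_nonneg (hf.add hg.neg) (by simp [h1]) hr
    have e2 := h.map_nonneg (hg.add hf.neg) (by simp [h1]) hr
    simp only [← sub_eq_add_neg, AddMonoidHom.sub_apply, sub_nonneg] at e1 e2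
    exact le_antisymm e2 e1
  ext r
  rcases le_total 0 r with hr | hr
  · exact key r hr
  · have := key (-r) (neg_nonneg.2 hr)
    rwa [map_neg, map_neg, neg_inj] at this

/-- A general element is a difference of positive ones, `g = 2 ^ n • e - (2 ^ n • e - g)`. -/
theorem exists_isLocallyBounded (h : IsDivisibleMonotoneComplete e) (g : G) :
    ∃ f : ℝ →+ G, f 1 = g ∧ IsLocallyBounded f := by
  obtain ⟨n, hn⟩ := h.exists_pow g
  obtain ⟨f1, h1, hf1⟩ := h.exists_monotone_addMonoidHom (nsmul_nonneg h.unit_nonneg (2 ^ n))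
  obtain ⟨f2, h2, hf2⟩ := h.exists_monotone_addMonoidHom (sub_nonneg.2 hn)
  exact ⟨f1 + -f2, by simp [h1, h2],
    (IsLocallyBounded.of_monotone hf1).add (IsLocallyBounded.of_monotone hf2).neg⟩

/-- The unique locally bounded additive map from the reals that sends `1` to `g`. -/
noncomputable def smulHom (h : IsDivisibleMonotoneComplete e) (g : G) : ℝ →+ G :=
  (h.exists_isLocallyBounded g).choose

theorem smulHom_one (h : IsDivisibleMonotoneComplete e) (g : G) : h.smulHom g 1 = g :=
  (h.exists_isLocallyBounded g).choose_spec.1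

theorem isLocallyBounded_smulHom (h : IsDivisibleMonotoneComplete e) (g : G) :
    IsLocallyBounded (h.smulHom g) :=
  (h.exists_isLocallyBounded g).choose_spec.2

/-- The real vector space structure. -/
@[reducible]
noncomputable def realModule (h : IsDivisibleMonotoneComplete e) : Module ℝ G :=
  letI : SMul ℝ G := ⟨fun r g => h.smulHom g r⟩
  -- Additivity in the vector and associativity each compare two locally bounded additive maps of
  -- the scalar `r` that agree at `1`.
  Module.ofMinimalAxioms
    (fun r x y => by
      have := h.eq_of_map_one_eq (h.isLocallyBounded_smulHom (x + y))
        ((h.isLocallyBounded_smulHom x).add (h.isLocallyBounded_smulHom y))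
        (by simp [smulHom_one])
      exact DFunLike.congr_fun this r)
    (fun r s x => map_add (h.smulHom x) r s)
    (fun r s x => by
      have := h.eq_of_map_one_eq (h.isLocallyBounded_smulHom (h.smulHom x s))
        ((h.isLocallyBounded_smulHom x).comp_mulRight s) (by simp [smulHom_one])
      exact (DFunLike.congr_fun this r).symm)
    (fun x => h.smulHom_one x)

theorem isOrderedModule (h : IsDivisibleMonotoneComplete e) :
    letI := h.realModule
    IsOrderedModule ℝ G :=
  letI := h.realModule
  IsOrderedModule.of_smul_nonneg fun r hr x hx =>
    h.map_nonneg (h.isLocallyBounded_smulHom x) (by rwa [smulHom_one]) hr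

end IsDivisibleMonotoneComplete

/-! ### Order unit spaces from Archimedean ordered vector spaces. -/

section OrderUnit

variable {V : Type v} [AddCommGroup V] [Module ℝ V] [PartialOrder V] [IsOrderedAddMonoid V]
  [IsOrderedModule ℝ V]

theorem exists_bounds_of_ouNorm_lt {u x : V} (h : ∀ v : V, ∃ l : ℝ, 0 ≤ l ∧ -(l • u) ≤ v ∧ v ≤ l • u)
    (hu : 0 ≤ u) {l : ℝ} (hx : ouNorm u x < l) : -(l • u) ≤ x ∧ x ≤ l • u := by
  obtain ⟨m, ⟨_, h1, h2⟩, hm⟩ := exists_lt_of_csInf_lt (h x) hx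
  have := smul_le_smul_of_nonneg_right hm.le hu
  exact ⟨(neg_le_neg this).trans h1, h2.trans this⟩

theorem isOrderUnitSpace_of_archimedean {u : V} (hu : 0 ≤ u) (hunit : ∀ v : V, ∃ n : ℕ, v ≤ n • u)
    (harch : ∀ v : V, (∀ n : ℕ, n • v ≤ u) → v ≤ 0) : IsOrderUnitSpace u := by
  have hbound : ∀ v : V, ∃ l : ℝ, 0 ≤ l ∧ -(l • u) ≤ v ∧ v ≤ l • u := by
    intro v
    obtain ⟨n, hn⟩ := hunit v
    obtain ⟨m, hm⟩ := hunit (-v)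
    have h1 := smul_nonneg (Nat.cast_nonneg (α := ℝ) n) hu
    have h2 := smul_nonneg (Nat.cast_nonneg (α := ℝ) m) hu
    rw [← Nat.cast_smul_eq_nsmul ℝ] at hn hm
    refine ⟨n + m, by positivity, ?_, ?_⟩
    · rw [neg_le, add_smul]; exact hm.trans (le_add_of_nonneg_left h1)
    · rw [add_smul]; exact hn.trans (le_add_of_nonneg_right h2)
  have hle : ∀ v : V, (∀ ε : ℝ, 0 < ε → v ≤ ε • u) → v ≤ 0 := by
    intro v hv
    refine harch v fun n => ?_
    have h1 := smul_le_smul_of_nonneg_left (hv (1 / (n + 1)) (by positivity))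
      (Nat.cast_nonneg (α := ℝ) n)
    rw [Nat.cast_smul_eq_nsmul, smul_smul] at h1
    refine h1.trans (smul_le_of_le_one_left hu ?_)
    rw [mul_one_div]
    exact div_le_one_of_le₀ (by linarith) (by positivity)
  refine ⟨hu, hbound, fun v hv => ?_, fun v hv => ?_⟩
  · have h1 := fun (ε : ℝ) (hε : 0 < ε) =>
      exists_bounds_of_ouNorm_lt (x := v) hbound hu (hv.trans_lt hε)
    refine le_antisymm (hle v fun ε hε => (h1 ε hε).2) ?_
    rw [← neg_nonpos]
    exact hle _ fun ε hε => neg_le.1 (h1 ε hε).1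
  · rw [← neg_nonpos]
    refine hle _ fun ε hε => ?_
    obtain ⟨p, hp, hvp⟩ := hv ε hε
    have h1 := (exists_bounds_of_ouNorm_lt hbound hu hvp).1
    rw [neg_le]
    exact h1.trans (sub_le_self _ hp)

end OrderUnit

/-- A directed-complete effect algebra with a halving is the unit interval of a directed-complete
order unit space. -/
theorem exists_dcous {E : Type v} [PCM E] {one : E} {hf : E → E} (hE : IsEffectAlgebra one)
    (hh : IsHalving hf) (hdc : IsDirectedComplete (PLe (M := E))) :
    ∃ (V : DCOUS.{v}) (ι : E ≃ Set.Icc (0 : V.carrier) V.unit),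
      ∀ x y z, PCM.oplus x y = some z ↔ PCM.oplus (ι x) (ι y) = some (ι z) := by
  obtain ⟨G, _, _, _, ι, hι⟩ := exists_isUnitInterval hE hh
  have h := hι.isDivisibleMonotoneComplete hdc
  let := h.realModule
  have := h.isOrderedModule
  have hmem : ∀ x, ι x ∈ Set.Icc (0 : G) (ι one) := fun x => ⟨hι.map_nonneg x, hι.map_le_one x⟩
  let ι' : E ≃ Set.Icc (0 : G) (ι one) := Equiv.ofBijective (fun x => ⟨ι x, hmem x⟩)
    ⟨fun x y hxy => hι.injective (congrArg Subtype.val hxy), fun g => by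
      obtain ⟨x, hx⟩ := (hι.mem_range g.1).1 g.2
      exact ⟨x, Subtype.ext hx⟩⟩
  have hle : ∀ x y, ι' x ≤ ι' y ↔ PLe x y := fun x y => hι.le_iff
  let V : DCOUS.{v} :=
    { carrier := G
      unit := ι one
      isOrderUnitSpace := isOrderUnitSpace_of_archimedean h.unit_nonneg
        (fun v => (h.exists_pow v).imp' (fun n => 2 ^ n) fun _ hn => hn)
        fun v hv => h.le_zero_of_nsmul_le hv
      directedComplete := by
        intro U hU
        obtain ⟨s, hs1, hs2⟩ := hdc (ι' ⁻¹' U) (by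
          intro x hx y hy
          obtain ⟨z, hz, hxz, hyz⟩ := hU _ hx _ hy
          obtain ⟨z, rfl⟩ := ι'.surjective z
          exact ⟨z, hz, (hle _ _).1 hxz, (hle _ _).1 hyz⟩)
        refine ⟨ι' s, fun x hx => ?_, fun b hb => ?_⟩
        · obtain ⟨x, rfl⟩ := ι'.surjective x
          exact (hle _ _).2 (hs1 x hx)
        · obtain ⟨b, rfl⟩ := ι'.surjective b
          exact (hle _ _).2 (hs2 b fun x hx => (hle _ _).1 (hb _ hx)) }
  exact ⟨V, ι', fun x y z => hι.add_iff.trans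
    (DCOUS.oplus_eq_some (V := V) (x := ι' x) (y := ι' y) (z := ι' z)).symm⟩

/-! ### Full faithfulness of the unit interval functor. -/

namespace DCOUS

variable {V W : DCOUS.{v}}

/-- The element `-x` is the norm limit of the positive elements `(1 / 2) ^ n • V.unit - x`, and the
cone is closed. -/
theorem le_zero_of_pow_smul_le {x : V.carrier} (hx : ∀ n : ℕ, (2 : ℝ) ^ n • x ≤ V.unit) :
    x ≤ 0 := by
  rw [← neg_nonneg]
  refine V.isOrderUnitSpace.cone_closed _ fun ε hε => ?_
  obtain ⟨n, hn⟩ := exists_pow_lt_of_lt_one hε (show (1 / 2 : ℝ) < 1 by norm_num)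
  have hp : (0 : ℝ) ≤ (1 / 2) ^ n := by positivity
  have h0 := smul_nonneg hp V.isOrderUnitSpace.unit_nonneg
  refine ⟨(1 / 2 : ℝ) ^ n • V.unit - x, ?_, ?_⟩
  · have := smul_le_smul_of_nonneg_left (hx n) hp
    rw [smul_smul, ← mul_pow] at this
    norm_num at this
    rw [sub_nonneg]
    simpa using this
  · rw [show -x - ((1 / 2 : ℝ) ^ n • V.unit - x) = -((1 / 2 : ℝ) ^ n • V.unit) by abel]
    exact (ouNorm_le hp le_rfl ((neg_nonpos.2 h0).trans h0)).trans_lt hn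

/-- Additive maps from the real unit interval are multiples of their value at one. -/
theorem eq_smul_of_additive {ψ : Set.Icc (0 : ℝ) 1 → Set.Icc (0 : V.carrier) V.unit}
    (hψ : ∀ l m n : Set.Icc (0 : ℝ) 1, (l : ℝ) + m = n →
      PCM.oplus (ψ l) (ψ m) = some (ψ n)) (l : Set.Icc (0 : ℝ) 1) :
    (ψ l : V.carrier) = (l : ℝ) • (ψ 1 : V.carrier) := by
  -- The deviation from linearity is additive and vanishes at `1`. Its range is therefore closed
  -- under negation (pass from `l` to `1 - l`) and under doubling (negate first if `l > 1 / 2`). So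
  -- every `2 ^ n • D l` is again a value of `D`, hence below the unit, which forces `D ≤ 0` and
  -- then `D = 0`.
  let D : Set.Icc (0 : ℝ) 1 → V.carrier := fun l => ψ l - (l : ℝ) • (ψ 1 : V.carrier)
  have hD : ∀ l m n : Set.Icc (0 : ℝ) 1, (l : ℝ) + m = n → D l + D m = D n := by
    intro l m n h
    have := oplus_eq_some.1 (hψ l m n h)
    simp only [D, ← this, ← h, add_smul]
    abel
  have hD1 : D 1 = 0 := by simp [D]
  have hsymm : ∀ l : Set.Icc (0 : ℝ) 1, ∃ m : Set.Icc (0 : ℝ) 1,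
      (l : ℝ) + m = 1 ∧ D m = -D l := by
    intro l
    refine ⟨⟨1 - l, by linarith [l.2.2], by linarith [l.2.1]⟩, by simp, ?_⟩
    rw [eq_neg_iff_add_eq_zero, ← hD1]
    exact hD _ _ _ (by simp)
  have hdouble' : ∀ l : Set.Icc (0 : ℝ) 1, (l : ℝ) ≤ 1 / 2 → ∃ m, D m = D l + D l := fun l hl =>
    ⟨⟨l + l, by linarith [l.2.1], by linarith⟩, (hD _ _ _ rfl).symm⟩
  have hdouble : ∀ l, ∃ m, D m = D l + D l := by
    intro l
    rcases le_total (l : ℝ) (1 / 2) with hl | hl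
    · exact hdouble' l hl
    · obtain ⟨m, hm, hm'⟩ := hsymm l
      obtain ⟨k, hk⟩ := hdouble' m (by linarith)
      obtain ⟨j, _, hj⟩ := hsymm k
      exact ⟨j, by rw [hj, hk, hm']; abel⟩
  have hpow : ∀ (n : ℕ) l, ∃ m, D m = (2 : ℝ) ^ n • D l := by
    intro n
    induction n with
    | zero => exact fun l => ⟨l, by simp⟩
    | succ n ih =>
      intro l
      obtain ⟨m, hm⟩ := ih l
      obtain ⟨k, hk⟩ := hdouble m
      exact ⟨k, by rw [hk, hm, ← two_smul ℝ, smul_smul, pow_succ']⟩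
  have hle : ∀ l, D l ≤ 0 := fun l => le_zero_of_pow_smul_le fun n => by
    obtain ⟨m, hm⟩ := hpow n l
    rw [← hm]
    exact (sub_le_self _ (smul_nonneg m.2.1 (ψ 1).2.1)).trans (ψ m).2.2
  obtain ⟨m, _, hm⟩ := hsymm l
  have h1 := hle m
  rw [hm, neg_nonpos] at h1
  exact sub_eq_zero.1 (le_antisymm (hle l) h1)

theorem exists_eq_smul_of_nonneg {v : V.carrier} (hv : 0 ≤ v) :
    ∃ (L : ℝ) (_ : 0 < L) (x : Set.Icc (0 : V.carrier) V.unit), v = L • (x : V.carrier) := by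
  obtain ⟨l, hl, _, h2⟩ := V.isOrderUnitSpace.order_unit v
  have hL : 0 < l + 1 := by linarith
  refine ⟨l + 1, hL, ⟨(l + 1)⁻¹ • v, smul_nonneg (inv_nonneg.2 hL.le) hv, ?_⟩, ?_⟩
  · rw [inv_smul_le_iff_of_pos hL]
    exact h2.trans (smul_le_smul_of_nonneg_right (by linarith) V.isOrderUnitSpace.unit_nonneg)
  · exact (smul_inv_smul₀ hL.ne' v).symm

theorem smul_mem_Icc {l : ℝ} (h0 : 0 ≤ l) (h1 : l ≤ 1) (x : Set.Icc (0 : V.carrier) V.unit) :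
    l • (x : V.carrier) ∈ Set.Icc (0 : V.carrier) V.unit :=
  ⟨smul_nonneg h0 x.2.1, (smul_le_of_le_one_left x.2.1 h1).trans x.2.2⟩

theorem exists_eq_smul_sub (v : V.carrier) :
    ∃ (L : ℝ) (_ : 0 < L) (x y : Set.Icc (0 : V.carrier) V.unit),
      v = L • (x - y : V.carrier) := by
  obtain ⟨l, hl, h1, h2⟩ := V.isOrderUnitSpace.order_unit v
  -- The element `v + l • V.unit` lies between `0` and `(2 * l) • V.unit`; the extra `1` keeps the
  -- divisor positive when `l = 0`.
  have hL : 0 < 2 * l + 1 := by linarith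
  have hu := V.isOrderUnitSpace.unit_nonneg
  have hle : (2 * l + 1)⁻¹ * l ≤ 1 := by
    rw [inv_mul_le_iff₀ hL]; linarith
  have hx : (2 * l + 1)⁻¹ • (v + l • V.unit) ∈ Set.Icc (0 : V.carrier) V.unit := by
    refine ⟨smul_nonneg (inv_nonneg.2 hL.le) (neg_le_iff_add_nonneg.1 h1), ?_⟩
    rw [inv_smul_le_iff_of_pos hL, add_smul, two_mul, add_smul, one_smul]
    exact (add_le_add_left h2 _).trans (le_add_of_nonneg_right hu)
  have hy := smul_mem_Icc (V := V) (by positivity) hle ⟨V.unit, hu, le_rfl⟩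
  refine ⟨2 * l + 1, hL, ⟨_, hx⟩, ⟨_, hy⟩, ?_⟩
  change v = (2 * l + 1) • ((2 * l + 1)⁻¹ • (v + l • V.unit) - ((2 * l + 1)⁻¹ * l) • V.unit)
  rw [mul_smul, ← smul_sub, smul_inv_smul₀ hL.ne', add_sub_cancel_right]

instance : (interval.{v}).Faithful where
  map_injective {V W} f g h := by
    have h1 : ∀ x : Set.Icc (0 : V.carrier) V.unit,
        DCOUS.Hom.toLin f (x : V.carrier) = DCOUS.Hom.toLin g x := fun x =>
      congrArg Subtype.val (congrFun (congrArg (fun k => EA.Hom.toFun (DCEAc.Hom.hom k)) h) x)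
    refine DCOUS.Hom.ext (LinearMap.ext fun v => ?_)
    obtain ⟨L, _, x, y, rfl⟩ := exists_eq_smul_sub v
    rw [map_smul, map_smul, map_sub, map_sub, h1, h1]

section Extension

variable (φ : Set.Icc (0 : V.carrier) V.unit → Set.Icc (0 : W.carrier) W.unit)

/-- The graph of the linear extension of a map between unit intervals. -/
def ExtensionRel (v : V.carrier) (w : W.carrier) : Prop :=
  ∃ (L : ℝ) (_ : 0 < L) (x y : Set.Icc (0 : V.carrier) V.unit),
    v = L • (x - y : V.carrier) ∧ w = L • (φ x - φ y : W.carrier)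

variable {φ}

theorem ExtensionRel.neg {v : V.carrier} {w : W.carrier} (h : ExtensionRel φ v w) :
    ExtensionRel φ (-v) (-w) := by
  obtain ⟨L, hL, x, y, rfl, rfl⟩ := h
  exact ⟨L, hL, y, x, by rw [← smul_neg, neg_sub], by rw [← smul_neg, neg_sub]⟩

/-- Over the common factor `L + M` the sum becomes a difference of convex combinations with weights
`L / (L + M)` and `M / (L + M)`, and `φ` preserves such combinations. -/
theorem ExtensionRel.add (hadd : IsAdditive φ) (hact : ∀ (l : Set.Icc (0 : ℝ) 1) x,
      φ (V.intervalAction.act l x) = W.intervalAction.act l (φ x))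
    {v v' : V.carrier} {w w' : W.carrier} (h : ExtensionRel φ v w) (h' : ExtensionRel φ v' w') :
    ExtensionRel φ (v + v') (w + w') := by
  obtain ⟨L, hL, x, y, rfl, rfl⟩ := h
  obtain ⟨M, hM, x', y', rfl, rfl⟩ := h'
  have hLM : 0 < L + M := by linarith
  let a : Set.Icc (0 : ℝ) 1 := ⟨L / (L + M), by positivity, div_le_one_of_le₀ (by linarith) hLM.le⟩
  let b : Set.Icc (0 : ℝ) 1 := ⟨M / (L + M), by positivity, div_le_one_of_le₀ (by linarith) hLM.le⟩
  have hab : (a : ℝ) + b = 1 := by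
    change L / (L + M) + M / (L + M) = 1
    rw [← add_div, div_self hLM.ne']
  have hLa : (L + M) * (a : ℝ) = L := mul_div_cancel₀ _ hLM.ne'
  have hMb : (L + M) * (b : ℝ) = M := mul_div_cancel₀ _ hLM.ne'
  have hmix : ∀ x x' : Set.Icc (0 : V.carrier) V.unit,
      ∃ z : Set.Icc (0 : V.carrier) V.unit,
        (z : V.carrier) = (a : ℝ) • (x : V.carrier) + (b : ℝ) • (x' : V.carrier) ∧
        (φ z : W.carrier) = (a : ℝ) • (φ x : W.carrier) + (b : ℝ) • (φ x' : W.carrier) := by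
    intro x x'
    have hle : (a : ℝ) • (x : V.carrier) + (b : ℝ) • (x' : V.carrier) ≤ V.unit := by
      calc _ ≤ (a : ℝ) • V.unit + (b : ℝ) • V.unit :=
            add_le_add (smul_le_smul_of_nonneg_left x.2.2 a.2.1)
              (smul_le_smul_of_nonneg_left x'.2.2 b.2.1)
        _ = V.unit := by rw [← add_smul, hab, one_smul]
    refine ⟨⟨_, add_nonneg (smul_nonneg a.2.1 x.2.1) (smul_nonneg b.2.1 x'.2.1), hle⟩, rfl, ?_⟩
    have h1 := hadd.2 (V.intervalAction.act a x) (V.intervalAction.act b x')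
      ⟨_, add_nonneg (smul_nonneg a.2.1 x.2.1) (smul_nonneg b.2.1 x'.2.1), hle⟩
      (oplus_eq_some.2 rfl)
    rw [hact, hact] at h1
    exact (oplus_eq_some.1 h1).symm
  obtain ⟨z, hz, hz'⟩ := hmix x x'
  obtain ⟨t, ht, ht'⟩ := hmix y y'
  refine ⟨L + M, hLM, z, t, ?_, ?_⟩
  · rw [hz, ht, add_sub_add_comm, ← smul_sub, ← smul_sub, smul_add, smul_smul, smul_smul, hLa, hMb]
  · rw [hz', ht', add_sub_add_comm, ← smul_sub, ← smul_sub, smul_add, smul_smul, smul_smul, hLa,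
      hMb]

/-- By additivity the difference `w - w'` is related to `0`, and a representation `0 = L • (x - y)`
forces `x = y`. -/
theorem ExtensionRel.unique (hadd : IsAdditive φ) (hact : ∀ (l : Set.Icc (0 : ℝ) 1) x,
      φ (V.intervalAction.act l x) = W.intervalAction.act l (φ x))
    {v : V.carrier} {w w' : W.carrier} (h : ExtensionRel φ v w) (h' : ExtensionRel φ v w') :
    w = w' := by
  obtain ⟨L, hL, x, y, hv, hw⟩ := h.add hadd hact h'.neg
  rw [add_neg_cancel, eq_comm, smul_eq_zero_iff_right hL.ne', sub_eq_zero] at hv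
  rw [Subtype.ext hv, sub_self, smul_zero, add_neg_eq_zero] at hw
  exact hw

theorem ExtensionRel.of_smul (hadd : IsAdditive φ) {L : ℝ} (hL : 0 < L)
    (x : Set.Icc (0 : V.carrier) V.unit) :
    ExtensionRel φ (L • (x : V.carrier)) (L • (φ x : W.carrier)) := by
  refine ⟨L, hL, x, PCM.zero, ?_, ?_⟩
  · change _ = L • ((x : V.carrier) - 0)
    rw [sub_zero]
  · rw [hadd.1]
    change _ = L • ((φ x : W.carrier) - 0)
    rw [sub_zero]

theorem ExtensionRel.smul {v : V.carrier} {w : W.carrier}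
    (h : ExtensionRel φ v w) (c : ℝ) : ExtensionRel φ (c • v) (c • w) := by
  have hpos : ∀ c : ℝ, 0 < c → ExtensionRel φ (c • v) (c • w) := by
    intro c hc
    obtain ⟨L, hL, x, y, rfl, rfl⟩ := h
    exact ⟨c * L, mul_pos hc hL, x, y, by rw [mul_smul], by rw [mul_smul]⟩
  rcases lt_trichotomy c 0 with hc | rfl | hc
  · have := (hpos (-c) (neg_pos.2 hc)).neg
    rwa [neg_smul, neg_smul, neg_neg, neg_neg] at this
  · rw [zero_smul, zero_smul]
    exact ⟨1, one_pos, PCM.zero, PCM.zero, by rw [sub_self, smul_zero], by rw [sub_self, smul_zero]⟩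
  · exact hpos c hc

/-- An additive map between unit intervals that preserves scalar multiplication extends to a
morphism of order unit spaces. -/
theorem exists_hom_extension (hadd : IsAdditive φ) (hact : ∀ (l : Set.Icc (0 : ℝ) 1) x,
      φ (V.intervalAction.act l x) = W.intervalAction.act l (φ x)) :
    ∃ f : DCOUS.Hom V W, ∀ x : Set.Icc (0 : V.carrier) V.unit, f.toLin x = φ x := by
  have htotal : ∀ v, ∃ w, ExtensionRel φ v w := fun v => by
    obtain ⟨L, hL, x, y, rfl⟩ := exists_eq_smul_sub v
    exact ⟨_, L, hL, x, y, rfl, rfl⟩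
  choose F hF using htotal
  let f : V.carrier →ₗ[ℝ] W.carrier :=
    { toFun := F
      map_add' := fun v v' => (hF _).unique hadd hact ((hF v).add hadd hact (hF v'))
      map_smul' := fun c v => (hF _).unique hadd hact ((hF v).smul c) }
  have hf : ∀ (L : ℝ) (_ : 0 < L) (x : Set.Icc (0 : V.carrier) V.unit),
      f (L • (x : V.carrier)) = L • (φ x : W.carrier) := fun L hL x =>
    (hF _).unique hadd hact (ExtensionRel.of_smul hadd hL x)
  have hf1 : ∀ x : Set.Icc (0 : V.carrier) V.unit, f x = φ x := fun x => by
    have := hf 1 one_pos x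
    rwa [one_smul, one_smul] at this
  have hnonneg : ∀ v, 0 ≤ v → 0 ≤ f v := fun v hv => by
    obtain ⟨L, hL, x, rfl⟩ := exists_eq_smul_of_nonneg hv
    rw [hf L hL]
    exact smul_nonneg hL.le (φ x).2.1
  have hmono : ∀ v v', v ≤ v' → f v ≤ f v' := fun v v' h => by
    rw [← sub_nonneg, ← map_sub]
    exact hnonneg _ (sub_nonneg.2 h)
  have hunit : f V.unit ≤ W.unit := by
    rw [hf1 ⟨V.unit, V.isOrderUnitSpace.unit_nonneg, le_rfl⟩]
    exact (φ _).2.2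
  refine ⟨⟨f, hnonneg, fun v => le_csInf (V.isOrderUnitSpace.order_unit v) ?_⟩, hf1⟩
  rintro l ⟨hl, h1, h2⟩
  have hlu : l • f V.unit ≤ l • W.unit := smul_le_smul_of_nonneg_left hunit hl
  refine ouNorm_le hl ?_ ?_
  · have := hmono _ _ h1
    rw [map_neg, map_smul] at this
    exact (neg_le_neg hlu).trans this
  · have := hmono _ _ h2
    rw [map_smul] at this
    exact this.trans hlu

end Extension

instance : (interval.{v}).Full where
  map_surjective {V W} g := by
    obtain ⟨f, hf⟩ := exists_hom_extension (V := V) (W := W)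
      (φ := EA.Hom.toFun (DCEAc.Hom.hom g)) (EA.Hom.additive _) (DCEAc.Hom.map_act g)
    exact ⟨f, DCEAc.Hom.ext (EA.Hom.ext (funext fun x => Subtype.ext (hf x)))⟩

end DCOUS

/-! ### Convex actions from halving, and essential surjectivity. -/

theorem ConvexAction.isHalving {M : Type v} [PCM M] {one : M} (hM : IsEffectAlgebra one)
    (A : ConvexAction M) : IsHalving (A.act ⟨1 / 2, by norm_num, by norm_num⟩) where
  additive := ⟨by
    have := A.act_oplus ⟨1 / 2, by norm_num, by norm_num⟩ _ _ _ (PCM.zero_oplus (PCM.zero : M))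
    exact hM.eq_zero_of_add_eq this, fun x y z h => A.act_oplus _ x y z h⟩
  add_self x := by
    have := A.act_add ⟨1 / 2, by norm_num, by norm_num⟩ ⟨1 / 2, by norm_num, by norm_num⟩ 1 x
      (by norm_num)
    rwa [A.one_act] at this

/-- A directed-complete effect algebra with a halving has a convex action, and additive maps from
the real unit interval to it are orbits of this action. -/
theorem exists_convexAction {E : Type v} [PCM E] {one : E} {hf : E → E}
    (hE : IsEffectAlgebra one) (hh : IsHalving hf) (hdc : IsDirectedComplete (PLe (M := E))) :
    ∃ A : ConvexAction E, ∀ ψ : Set.Icc (0 : ℝ) 1 → E,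
      (∀ l m n : Set.Icc (0 : ℝ) 1, (l : ℝ) + m = n → PCM.oplus (ψ l) (ψ m) = some (ψ n)) →
        ∀ l, ψ l = A.act l (ψ 1) := by
  obtain ⟨V, ι, hι⟩ := exists_dcous hE hh hdc
  refine ⟨{ act := fun l x => ι.symm (V.intervalAction.act l (ι x)), act_act := ?_, act_add := ?_,
            one_act := ?_, act_oplus := ?_ }, fun ψ hψ l => ?_⟩
  · intro l m x
    rw [ι.apply_symm_apply, V.intervalAction.act_act]
  · intro l m n x h
    rw [hι]
    simpa using V.intervalAction.act_add l m n (ι x) h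
  · intro x
    rw [V.intervalAction.one_act, ι.symm_apply_apply]
  · intro l x y z h
    rw [hι] at h ⊢
    simpa using V.intervalAction.act_oplus l _ _ _ h
  · refine ι.injective ?_
    rw [ι.apply_symm_apply]
    exact Subtype.ext (DCOUS.eq_smul_of_additive (ψ := fun l => ι (ψ l))
      (fun l m n h => (hι _ _ _).1 (hψ l m n h)) l)

instance : (DCOUS.interval.{v}).EssSurj where
  mem_essImage E := by
    obtain ⟨V, ι, hι⟩ := exists_dcous E.toEA.isEffectAlgebra
      (E.action.isHalving E.toEA.isEffectAlgebra) E.directedComplete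
    -- The space was built from the halving alone; that its scalars give back the whole action
    -- follows since `l ↦ ι (E.action.act l x)` is additive.
    have hact : ∀ l x, ι (E.action.act l x) = V.intervalAction.act l (ι x) := fun l x => by
      refine Subtype.ext ((DCOUS.eq_smul_of_additive (ψ := fun l => ι (E.action.act l x))
        (fun l m n h => (hι _ _ _).1 (E.action.act_add l m n x h)) l).trans ?_)
      simp only [E.action.one_act]
      rfl
    have hzero : ι PCM.zero = PCM.zero := by
      have h1 := (hι _ _ _).1 (PCM.zero_oplus (PCM.zero : E.toEA.carrier))
      exact V.intervalEA.isEffectAlgebra.eq_zero_of_add_eq h1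
    have hzero' : ι.symm PCM.zero = PCM.zero := by rw [ι.symm_apply_eq, hzero]
    have hadd' : ∀ x y z, PCM.oplus x y = some z →
        PCM.oplus (ι.symm x) (ι.symm y) = some (ι.symm z) := fun x y z h => by
      rw [hι]
      simpa only [ι.apply_symm_apply] using h
    have hact' : ∀ l x, ι.symm (V.intervalAction.act l x) = E.action.act l (ι.symm x) :=
      fun l x => by rw [ι.symm_apply_eq, hact, ι.apply_symm_apply]
    let hom : V.intervalDCEAc ⟶ E :=
      { hom := { toFun := ι.symm, additive := ⟨hzero', hadd'⟩ }
        map_act := hact' }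
    let inv : E ⟶ V.intervalDCEAc :=
      { hom := { toFun := ι, additive := ⟨hzero, fun x y z h => (hι _ _ _).1 h⟩ }
        map_act := hact }
    exact ⟨V, ⟨{
      hom := hom
      inv := inv
      hom_inv_id := DCEAc.Hom.ext (EA.Hom.ext (funext fun x => ι.apply_symm_apply x))
      inv_hom_id := DCEAc.Hom.ext (EA.Hom.ext (funext fun x => ι.symm_apply_apply x)) }⟩⟩

theorem DCOUS.interval_isEquivalence : (DCOUS.interval.{v}).IsEquivalence where

section PCMEnriched

variable {C : Type u} [Category.{v} C] [PCMEnriched C] {A B D : C}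

theorem comp_pcm_zero (f : A ⟶ B) : f ≫ (PCM.zero : B ⟶ D) = PCM.zero :=
  (PCMEnriched.comp_additive_right f).1

theorem pcm_zero_comp (f : B ⟶ D) : (PCM.zero : A ⟶ B) ≫ f = PCM.zero :=
  (PCMEnriched.comp_additive_left f).1

theorem comp_oplus (f : A ⟶ B) {x y z : B ⟶ D} (h : PCM.oplus x y = some z) :
    PCM.oplus (f ≫ x) (f ≫ y) = some (f ≫ z) :=
  (PCMEnriched.comp_additive_right f).2 _ _ _ h

theorem oplus_comp {x y z : A ⟶ B} (h : PCM.oplus x y = some z) (f : B ⟶ D) :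
    PCM.oplus (x ≫ f) (y ≫ f) = some (z ≫ f) :=
  (PCMEnriched.comp_additive_left f).2 _ _ _ h

theorem comp_pLe (f : A ⟶ B) {x y : B ⟶ D} (h : PLe x y) : PLe (f ≫ x) (f ≫ y) :=
  (PCMEnriched.comp_additive_right f).pLe h

theorem pLe_comp {x y : A ⟶ B} (h : PLe x y) (f : B ⟶ D) : PLe (x ≫ f) (y ≫ f) :=
  (PCMEnriched.comp_additive_left f).pLe h

end PCMEnriched

/-! ### Splitting the scalars and the objects of an effectus. -/

section Effectus

variable {C : Type u} [Category.{v} C] [Effectus C]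

theorem pLe_truth {A : C} (p : Predicate A) : PLe p (Effectus.truth A) :=
  (Effectus.isEffectAlgebra A).pLe_one p

theorem predicate_antisymm {A : C} {p q : Predicate A} (h : PLe p q) (h' : PLe q p) : p = q :=
  (Effectus.isEffectAlgebra A).antisymm h h'

/-- The truth of the complement `y` of the identity is summable with the top, so it vanishes, and
hence `y` does. -/
theorem truth_unit : Effectus.truth (Effectus.unit : C) = 𝟙 _ := by
  obtain ⟨y, hy⟩ := (Effectus.isEffectAlgebra (Effectus.unit : C)).exists_ortho (𝟙 _)
  have h1 := oplus_comp (x := 𝟙 (Effectus.unit : C)) hy (Effectus.truth (Effectus.unit : C))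
  rw [Category.id_comp, PCM.oplus_comm] at h1
  have h2 := Effectus.eq_zero_of_comp_truth y
    ((Effectus.isEffectAlgebra _).eq_zero_of_perp_one _ ⟨_, h1⟩)
  rw [h2] at hy
  exact (Option.some.inj ((add_zero _).symm.trans hy)).symm

theorem eq_zero_of_comp_truth_pLe {A B : C} {f : A ⟶ B} {p : Predicate A}
    (h : PLe (f ≫ Effectus.truth B) p) (hp : p = PCM.zero) : f = PCM.zero := by
  subst hp
  exact Effectus.eq_zero_of_comp_truth f ((Effectus.isEffectAlgebra A).eq_zero_of_pLe_zero h)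

/-- Split monomorphisms are total. -/
theorem isTotal_of_comp_eq_id {A B : C} {f : A ⟶ B} {g : B ⟶ A} (h : f ≫ g = 𝟙 A) :
    IsTotal f := by
  refine predicate_antisymm (pLe_truth _) ?_
  have := comp_pLe f (pLe_truth (g ≫ Effectus.truth A))
  rwa [← Category.assoc, h, Category.id_comp] at this

/-- Complementary orthogonal scalars. -/
structure IsScalarSplitting (s t : (Effectus.unit : C) ⟶ Effectus.unit) : Prop where
  oplus : PCM.oplus s t = some (𝟙 _)
  comp_left : s ≫ t = PCM.zero
  comp_right : t ≫ s = PCM.zero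

namespace IsScalarSplitting

variable {s t : (Effectus.unit : C) ⟶ Effectus.unit}

theorem symm (h : IsScalarSplitting s t) : IsScalarSplitting t s :=
  ⟨(PCM.oplus_comm t s).trans h.oplus, h.comp_right, h.comp_left⟩

theorem idem (h : IsScalarSplitting s t) : s ≫ s = s := by
  have := comp_oplus s h.oplus
  rw [h.comp_left, Category.comp_id] at this
  exact Option.some.inj ((add_zero _).symm.trans this)

end IsScalarSplitting

/-- In an effectus with directed-complete scalars the unit scalar is the sum of orthogonal
idempotents `s`, which has a half, and `t`, which annihilates the self-summable scalars. -/
theorem exists_scalarSplitting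
    (hdc : IsDirectedComplete (PLe (M := (Effectus.unit : C) ⟶ Effectus.unit))) :
    ∃ s t h : (Effectus.unit : C) ⟶ Effectus.unit, IsScalarSplitting s t ∧
      PCM.oplus h h = some s ∧
        ∀ c : (Effectus.unit : C) ⟶ Effectus.unit, Perp c c → c ≫ t = PCM.zero := by
  have hM := Effectus.isEffectAlgebra (Effectus.unit : C)
  rw [truth_unit] at hM
  obtain ⟨⟨m, s, hs⟩, hmax⟩ := exists_maximal_of_chains_bounded
    (α := {b : (Effectus.unit : C) ⟶ Effectus.unit // Perp b b}) (r := fun a b => PLe a.1 b.1)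
    (by
      intro c hc
      have hcmp : ∀ a ∈ c, ∀ b ∈ c, PLe a.1 b.1 ∨ PLe b.1 a.1 := by
        intro a ha b hb
        by_cases hab : a = b
        · exact Or.inl (hab ▸ pLe_refl _)
        · exact hc ha hb hab
      have hperp : ∀ a ∈ c, ∀ b ∈ c, Perp a.1 b.1 := by
        intro a ha b hb
        rcases hcmp a ha b hb with h | h
        · exact b.2.mono h (pLe_refl _)
        · exact a.2.mono (pLe_refl _) h
      obtain ⟨z, hz1, hz2⟩ := hdc (Subtype.val '' c) (by
        rintro _ ⟨a, ha, rfl⟩ _ ⟨b, hb, rfl⟩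
        rcases hcmp a ha b hb with h | h
        · exact ⟨b.1, ⟨b, hb, rfl⟩, h, pLe_refl _⟩
        · exact ⟨a.1, ⟨a, ha, rfl⟩, pLe_refl _, h⟩)
      -- Summability with a fixed element means lying below its complement, so it passes to suprema.
      -- Using this once in each argument gives `z ⊥ z`.
      have hz : ∀ b ∈ c, Perp z b.1 := by
        intro b hb
        obtain ⟨b', hb'⟩ := hM.exists_ortho b.1
        rw [hM.perp_iff_pLe hb']
        refine hz2 _ ?_
        rintro _ ⟨a, ha, rfl⟩
        exact (hM.perp_iff_pLe hb').1 (hperp a ha b hb)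
      obtain ⟨z', hz'⟩ := hM.exists_ortho z
      refine ⟨⟨z, (hM.perp_iff_pLe hz').2 (hz2 _ ?_)⟩, fun a ha => hz1 _ ⟨a, ha, rfl⟩⟩
      rintro _ ⟨a, ha, rfl⟩
      exact (hM.perp_iff_pLe hz').1 (hz a ha).symm)
    (fun h h' => PLe.trans h h')
  obtain ⟨t, ht⟩ := hM.exists_ortho s
  -- As `m ⊕ m ⊕ k ⊕ k` is defined, `m ⊕ k` is self-summable; maximality of `m` gives `m ⊕ k = m`.
  have key : ∀ k e, PCM.oplus k k = some e → PLe e t → k = PCM.zero := by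
    intro k e hke het
    obtain ⟨w, hw, _⟩ := (pLe_refl s).oplus het ht
    rw [oplus_eq_add, ← hs, ← hke, oplus_eq_add, oplus_eq_add, add_add_add_comm] at hw
    obtain ⟨b, _, hb, _⟩ := exists_some_of_add_eq_some hw
    rw [hb] at hw
    have hbm : PLe b m := hmax ⟨b, w, hw⟩ ⟨k, hb⟩
    have hmb : PLe m b := ⟨k, hb⟩
    rw [hM.antisymm hbm hmb] at hb
    exact hM.eq_zero_of_add_eq hb
  have hr : ∀ c : (Effectus.unit : C) ⟶ Effectus.unit, Perp c c → c ≫ t = PCM.zero := by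
    rintro c ⟨d, hd⟩
    refine key _ _ (oplus_comp hd t) ?_
    have := pLe_comp (hM.pLe_one d) t
    rwa [Category.id_comp] at this
  have hl : ∀ c : (Effectus.unit : C) ⟶ Effectus.unit, Perp c c → t ≫ c = PCM.zero := by
    rintro c ⟨d, hd⟩
    refine key _ _ (comp_oplus t hd) ?_
    have := comp_pLe t (hM.pLe_one d)
    rwa [Category.comp_id] at this
  refine ⟨s, t, m, ⟨ht, ?_, ?_⟩, hs, hr⟩
  · have := oplus_comp hs t
    rw [hr m ⟨s, hs⟩, PCM.zero_oplus] at this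
    exact (Option.some.inj this).symm
  · have := comp_oplus t hs
    rw [hl m ⟨s, hs⟩, PCM.zero_oplus] at this
    exact (Option.some.inj this).symm

/-- The objects on which the scalar `s` acts as the identity. -/
def fixedBy (s : (Effectus.unit : C) ⟶ Effectus.unit) : ObjectProperty C :=
  fun A => Effectus.truth A ≫ s = Effectus.truth A

/-- The truth of `f` is fixed by `t`, so it is at most `truth A ≫ t = truth A ≫ s ≫ t = 0`. -/
theorem IsScalarSplitting.hom_eq_zero {s t : (Effectus.unit : C) ⟶ Effectus.unit}
    (h : IsScalarSplitting s t) {A B : C} (hA : fixedBy s A) (hB : fixedBy t B) (f : A ⟶ B) :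
    f = PCM.zero := by
  have h1 := pLe_comp (pLe_truth (f ≫ Effectus.truth B)) t
  rw [Category.assoc, show Effectus.truth B ≫ t = _ from hB] at h1
  refine eq_zero_of_comp_truth_pLe h1 ?_
  rw [← show Effectus.truth A ≫ s = _ from hA, Category.assoc, h.comp_left, comp_pcm_zero]

/-- The cotuple of the truth predicates lies below the top and already restricts to truth on every
summand. -/
theorem isTotal_colimit_ι {J : Type w} {F : Discrete J ⥤ C} {c : Cocone F} (hc : IsColimit c)
    (j : Discrete J) : IsTotal (c.ι.app j) := by
  let d : Cocone F := ⟨Effectus.unit, Discrete.natTrans fun j => Effectus.truth (F.obj j)⟩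
  refine predicate_antisymm (pLe_truth _) ?_
  have := comp_pLe (c.ι.app j) (pLe_truth (hc.desc d))
  rwa [hc.fac] at this

instance (s : (Effectus.unit : C) ⟶ Effectus.unit) :
    (fixedBy s).IsClosedUnderFiniteCoproducts where
  isClosedUnderColimitsOfShape J _ := ⟨by
    rintro X ⟨p⟩
    change Effectus.truth X ≫ s = Effectus.truth X
    refine p.isColimit.hom_ext fun j => ?_
    have h1 : p.ι.app j ≫ Effectus.truth X = _ := isTotal_colimit_ι p.isColimit j
    have h2 : Effectus.truth (p.diag.obj j) ≫ s = _ := p.prop_diag_obj j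
    change p.ι.app j ≫ _ = p.ι.app j ≫ _
    rw [← Category.assoc, h1, h2]⟩

/-- A summand `obj` of `A` with the property `P` through which all maps between `A` and objects
with this property factor. -/
structure Summand (P : ObjectProperty C) (A : C) where
  obj : C
  prop : P obj
  incl : obj ⟶ A
  proj : A ⟶ obj
  incl_proj : incl ≫ proj = 𝟙 obj
  comp_proj_incl : ∀ {X : C}, P X → ∀ g : X ⟶ A, g ≫ proj ≫ incl = g
  proj_incl_comp : ∀ {X : C}, P X → ∀ g : A ⟶ X, proj ≫ incl ≫ g = g

/-- The part of an object on which an idempotent scalar acts as the identity. -/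
theorem exists_scalar_part (himages : EffHasImages C) (hcompr : HasComprehensions C)
    (hcompat : FiltersComprehensionsCompatible C)
    {s t : (Effectus.unit : C) ⟶ Effectus.unit} (h : IsScalarSplitting s t) (A : C) :
    ∃ (X : C) (π : X ⟶ A) (ξ : A ⟶ X), fixedBy s X ∧ π ≫ ξ = 𝟙 X ∧
      PLe (ξ ≫ Effectus.truth X) (Effectus.truth A ≫ s) ∧
      ∀ ω : (Effectus.unit : C) ⟶ A, IsTotal ω → ω ≫ ξ ≫ π = s ≫ ω := by
  obtain ⟨X, π, hπ, hπ'⟩ := hcompr A (Effectus.truth A ≫ s)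
  obtain ⟨q, hq, hq'⟩ := himages _ _ π
  have hqp : PLe q (Effectus.truth A ≫ s) := hq' _ hπ.symm
  -- Compatibility concerns sharp predicates, so it is applied to the image `q` of `π`. Since `q ≤
  -- truth A ≫ s`, the map `π` is also a comprehension for `q`.
  obtain ⟨ξ, ⟨hξ, _⟩, hπξ⟩ := hcompat A X q π ⟨X, π, hq, hq'⟩ ⟨hq.symm, fun B f hf => by
    refine hπ' B f (predicate_antisymm ?_ (comp_pLe f (pLe_truth _)))
    rw [hf]
    exact comp_pLe f hqp⟩
  have hπtot := isTotal_of_comp_eq_id hπξ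
  refine ⟨X, π, ξ, ?_, hπξ, hξ.trans hqp, fun ω hω => ?_⟩
  · change Effectus.truth X ≫ s = Effectus.truth X
    rw [← show π ≫ _ = _ from hπtot, Category.assoc, ← hπ]
  have hωs : ω ≫ Effectus.truth A ≫ s = s := by
    rw [← Category.assoc, show ω ≫ _ = _ from hω, truth_unit, Category.id_comp]
  -- On states, `ξ ≫ π` fixes the part `s ≫ ω`, which factors through `π`, and kills `t ≫ ω`, whose
  -- image under `ξ` has truth at most `t ≫ s = 0`.
  obtain ⟨g, hg, _⟩ := hπ' _ (s ≫ ω) (by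
    rw [Category.assoc, Category.assoc, hωs, h.idem, show ω ≫ _ = _ from hω, truth_unit,
      Category.comp_id])
  have h1 : s ≫ ω ≫ ξ ≫ π = s ≫ ω := by
    rw [← Category.assoc, ← hg, Category.assoc, ← Category.assoc π, hπξ, Category.id_comp]
  have h2 : t ≫ ω ≫ ξ = PCM.zero := by
    refine eq_zero_of_comp_truth_pLe (p := t ≫ ω ≫ Effectus.truth A ≫ s) ?_ ?_
    · rw [Category.assoc, Category.assoc]
      exact comp_pLe t (comp_pLe ω (hξ.trans hqp))
    · rw [hωs, h.comp_right]
  have h3 := oplus_comp h.oplus (ω ≫ ξ ≫ π)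
  rw [h1, show t ≫ ω ≫ ξ ≫ π = (t ≫ ω ≫ ξ) ≫ π by simp only [Category.assoc], h2,
    pcm_zero_comp, Category.id_comp] at h3
  exact (Option.some.inj ((add_zero _).symm.trans h3)).symm

/-- Every object is the sum of its two parts determined by complementary orthogonal scalars. -/
theorem exists_summands (hstates : SeparatedByStates C) (himages : EffHasImages C)
    (hcompr : HasComprehensions C) (hcompat : FiltersComprehensionsCompatible C)
    {s t : (Effectus.unit : C) ⟶ Effectus.unit} (h : IsScalarSplitting s t) (A : C) :
    ∃ (R : Summand (fixedBy s) A) (S : Summand (fixedBy t) A),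
      PCM.oplus (R.proj ≫ R.incl) (S.proj ≫ S.incl) = some (𝟙 A) := by
  obtain ⟨X, π, ξ, hX, hπξ, hξ, hω⟩ := exists_scalar_part himages hcompr hcompat h A
  obtain ⟨Y, ρ, ζ, hY, hρζ, hζ, hω'⟩ := exists_scalar_part himages hcompr hcompat h.symm A
  have hsum : PCM.oplus (ξ ≫ π) (ζ ≫ ρ) = some (𝟙 A) := by
    obtain ⟨k, hk⟩ : Perp (ξ ≫ π) (ζ ≫ ρ) := by
      refine Effectus.perp_of_comp_truth _ _ ?_
      rw [Category.assoc, Category.assoc, show π ≫ _ = _ from isTotal_of_comp_eq_id hπξ,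
        show ρ ≫ _ = _ from isTotal_of_comp_eq_id hρζ]
      exact Perp.mono ⟨_, comp_oplus (Effectus.truth A) h.oplus⟩ hξ hζ
    rw [hk]
    -- At a state `ω` the sum takes the value `s ≫ ω ⊕ t ≫ ω = ω`.
    refine congrArg some (hstates _ _ _ _ fun ω hωt => ?_)
    have h1 := comp_oplus ω hk
    rw [hω ω hωt, hω' ω hωt, oplus_comp h.oplus ω] at h1
    rw [← Option.some.inj h1, Category.id_comp, Category.comp_id]
  refine ⟨⟨X, hX, π, ξ, hπξ, fun {Z} hZ g => ?_, fun {Z} hZ g => ?_⟩,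
    ⟨Y, hY, ρ, ζ, hρζ, fun {Z} hZ g => ?_, fun {Z} hZ g => ?_⟩, hsum⟩
  · have h1 := comp_oplus g hsum
    rw [← Category.assoc g ζ, h.hom_eq_zero hZ hY (g ≫ ζ), pcm_zero_comp, Category.comp_id] at h1
    exact Option.some.inj ((add_zero _).symm.trans h1)
  · have h1 := oplus_comp hsum g
    rw [Category.assoc, Category.assoc, h.symm.hom_eq_zero hY hZ (ρ ≫ g), comp_pcm_zero,
      Category.id_comp] at h1
    exact Option.some.inj ((add_zero _).symm.trans h1)
  · have h1 := comp_oplus g hsum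
    rw [← Category.assoc g ξ, h.symm.hom_eq_zero hZ hX (g ≫ ξ), pcm_zero_comp, Category.comp_id,
      PCM.zero_oplus] at h1
    exact Option.some.inj h1
  · have h1 := oplus_comp hsum g
    rw [Category.assoc, Category.assoc, h.hom_eq_zero hX hZ (π ≫ g), comp_pcm_zero,
      Category.id_comp, PCM.zero_oplus] at h1
    exact Option.some.inj h1

end Effectus

/-! ### Full subcategories of summands as effectuses. -/

section FullSubcategory

variable {C : Type u} [Category.{v} C]

section PCMEnriched

variable [PCMEnriched C] (P : ObjectProperty C)

instance fullSubcategoryHomPCM (A B : P.FullSubcategory) : PCM (A ⟶ B) where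
  zero := ObjectProperty.homMk PCM.zero
  oplus f g := (PCM.oplus f.hom g.hom).map ObjectProperty.homMk
  oplus_assoc f g h := by
    have := congrArg (Option.map (ObjectProperty.homMk (X := A) (Y := B)))
      (PCM.oplus_assoc f.hom g.hom h.hom)
    rw [Option.map_bind, Option.map_bind] at this
    rw [Option.bind_map, Option.bind_map]
    exact this
  oplus_comm f g := by rw [PCM.oplus_comm]
  zero_oplus f := by
    change (PCM.oplus PCM.zero f.hom).map _ = _
    rw [PCM.zero_oplus]
    rfl

variable {P}

theorem fullSubcategory_oplus_iff {A B : P.FullSubcategory} {f g h : A ⟶ B} :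
    PCM.oplus f g = some h ↔ PCM.oplus f.hom g.hom = some h.hom := by
  change (PCM.oplus f.hom g.hom).map _ = _ ↔ _
  rw [Option.map_eq_some_iff]
  constructor
  · rintro ⟨k, hk, rfl⟩
    exact hk
  · exact fun hk => ⟨_, hk, rfl⟩

theorem fullSubcategory_perp_iff {A B : P.FullSubcategory} {f g : A ⟶ B} :
    Perp f g ↔ Perp f.hom g.hom :=
  ⟨fun ⟨h, hh⟩ => ⟨h.hom, fullSubcategory_oplus_iff.1 hh⟩,
    fun ⟨h, hh⟩ => ⟨ObjectProperty.homMk h, fullSubcategory_oplus_iff.2 hh⟩⟩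

theorem fullSubcategory_pLe_iff {A B : P.FullSubcategory} {f g : A ⟶ B} :
    PLe f g ↔ PLe f.hom g.hom :=
  ⟨fun ⟨h, hh⟩ => ⟨h.hom, fullSubcategory_oplus_iff.1 hh⟩,
    fun ⟨h, hh⟩ => ⟨ObjectProperty.homMk h, fullSubcategory_oplus_iff.2 hh⟩⟩

instance fullSubcategoryPCMEnriched : PCMEnriched P.FullSubcategory where
  homPCM := fullSubcategoryHomPCM P
  comp_additive_right f := ⟨ObjectProperty.hom_ext _ (comp_pcm_zero f.hom), fun _ _ _ h =>
    fullSubcategory_oplus_iff.2 (comp_oplus f.hom (fullSubcategory_oplus_iff.1 h))⟩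
  comp_additive_left f := ⟨ObjectProperty.hom_ext _ (pcm_zero_comp f.hom), fun _ _ _ h =>
    fullSubcategory_oplus_iff.2 (oplus_comp (fullSubcategory_oplus_iff.1 h) f.hom)⟩

end PCMEnriched

instance fullSubcategoryFinPAC [FinPAC C] (P : ObjectProperty C)
    [P.IsClosedUnderFiniteCoproducts] : FinPAC P.FullSubcategory where
  compatible_sum {A B} f g := by
    rintro ⟨h, rfl, rfl⟩
    let BB : P.FullSubcategory := ⟨B.obj ⨿ B.obj, P.prop_coprod _ _ B.property B.property⟩
    -- The coproduct chosen in the subcategory need not be the ambient one; `φ` compares them.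
    let φ : B ⨿ B ⟶ BB := coprod.desc (ObjectProperty.homMk coprod.inl)
      (ObjectProperty.homMk coprod.inr)
    have hφ : ∀ k l : B ⟶ B, coprod.desc k l
        = φ ≫ (ObjectProperty.homMk (coprod.desc k.hom l.hom) : BB ⟶ B) := fun k l => by
      refine coprod.hom_ext ?_ ?_
      · rw [coprod.inl_desc, coprod.inl_desc_assoc]
        exact ObjectProperty.hom_ext _ (coprod.inl_desc _ _).symm
      · rw [coprod.inr_desc, coprod.inr_desc_assoc]
        exact ObjectProperty.hom_ext _ (coprod.inr_desc _ _).symm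
    rw [fullSubcategory_perp_iff]
    refine FinPAC.compatible_sum _ _ ⟨h.hom ≫ φ.hom, ?_, ?_⟩
    · rw [hφ, Category.assoc]
      rfl
    · rw [hφ, Category.assoc]
      rfl
  untying {A B} f g h := by
    rw [fullSubcategory_perp_iff] at h ⊢
    have := (PCMEnriched.comp_additive_left (coprod.desc (coprod.inl : B ⟶ B ⨿ B).hom
      (coprod.inr : B ⟶ B ⨿ B).hom)).perp (FinPAC.untying _ _ h)
    rwa [Category.assoc, Category.assoc, coprod.inl_desc, coprod.inr_desc] at this

variable {P : ObjectProperty C}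

theorem Summand.comp_incl_comp_proj {A : C} (R : Summand P A) {X : C} (f : X ⟶ R.obj) :
    (f ≫ R.incl) ≫ R.proj = f := by
  rw [Category.assoc, R.incl_proj, Category.comp_id]

theorem Summand.comp_proj_comp_incl {A : C} (R : Summand P A) {X : C} (hX : P X) (f : X ⟶ A) :
    (f ≫ R.proj) ≫ R.incl = f := by
  rw [Category.assoc, R.comp_proj_incl hX]

variable [Effectus C]

/-- A full subcategory that is closed under finite coproducts and reflects the unit object is an
effectus. -/
@[reducible]
def fullSubcategoryEffectus [P.IsClosedUnderFiniteCoproducts]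
    (R : Summand P (Effectus.unit : C)) : Effectus P.FullSubcategory where
  unit := ⟨R.obj, R.prop⟩
  truth A := ObjectProperty.homMk (Effectus.truth A.obj ≫ R.proj)
  -- Composition with `R.incl` and with `R.proj` are inverse additive bijections between predicates
  -- in the subcategory and in `C`, and they match the truth predicates. Each axiom is transported
  -- along them.
  isEffectAlgebra A :=
    { existsUnique_ortho := fun x => by
        obtain ⟨y, hy⟩ := (Effectus.isEffectAlgebra A.obj).exists_ortho (x.hom ≫ R.incl)
        refine ⟨ObjectProperty.homMk (y ≫ R.proj), ?_, fun z hz => ?_⟩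
        · have := oplus_comp (x := x.hom ≫ R.incl) hy R.proj
          rw [R.comp_incl_comp_proj] at this
          exact fullSubcategory_oplus_iff.2 this
        · have := oplus_comp (fullSubcategory_oplus_iff.1 hz) R.incl
          change PCM.oplus _ _ = some ((Effectus.truth A.obj ≫ R.proj) ≫ R.incl) at this
          rw [R.comp_proj_comp_incl A.property] at this
          rw [(Effectus.isEffectAlgebra A.obj).ortho_unique hy this]
          exact ObjectProperty.hom_ext _ (R.comp_incl_comp_proj z.hom).symm
      eq_zero_of_perp_one := fun x hx => by
        have := (PCMEnriched.comp_additive_left R.incl).perp (fullSubcategory_perp_iff.1 hx)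
        change Perp (x.hom ≫ R.incl) ((Effectus.truth A.obj ≫ R.proj) ≫ R.incl) at this
        rw [R.comp_proj_comp_incl A.property] at this
        have h0 := (Effectus.isEffectAlgebra A.obj).eq_zero_of_perp_one _ this
        refine ObjectProperty.hom_ext _ ?_
        rw [← R.comp_incl_comp_proj x.hom, h0, pcm_zero_comp]
        rfl }
  eq_zero_of_comp_truth {A B} f hf := by
    have h1 : (f.hom ≫ Effectus.truth B.obj ≫ R.proj) ≫ R.incl = PCM.zero ≫ R.incl :=
      congrArg (· ≫ R.incl) (congrArg InducedCategory.Hom.hom hf)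
    rw [← Category.assoc f.hom, R.comp_proj_comp_incl A.property, pcm_zero_comp] at h1
    exact ObjectProperty.hom_ext _ (Effectus.eq_zero_of_comp_truth _ h1)
  perp_of_comp_truth {A B} f g h := by
    have h1 := (PCMEnriched.comp_additive_left R.incl).perp (fullSubcategory_perp_iff.1 h)
    change Perp ((f.hom ≫ Effectus.truth B.obj ≫ R.proj) ≫ R.incl)
      ((g.hom ≫ Effectus.truth B.obj ≫ R.proj) ≫ R.incl) at h1
    rw [← Category.assoc f.hom, ← Category.assoc g.hom, R.comp_proj_comp_incl A.property,
      R.comp_proj_comp_incl A.property] at h1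
    exact fullSubcategory_perp_iff.2 (Effectus.perp_of_comp_truth _ _ h1)

variable (R : ∀ A : C, Summand P A)

/-- The functor to a full subcategory that sends every object to its summand. -/
def summandFunctor : C ⥤ P.FullSubcategory where
  obj A := ⟨(R A).obj, (R A).prop⟩
  map {A B} f := ObjectProperty.homMk ((R A).incl ≫ f ≫ (R B).proj)
  map_id A := ObjectProperty.hom_ext _ (by simp [(R A).incl_proj])
  map_comp {A B D} f g := ObjectProperty.hom_ext _ (by
    have := (R B).comp_proj_incl (R A).prop ((R A).incl ≫ f)
    simp only [Category.assoc] at this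
    simp [reassoc_of% this])

/-- The summand functor is left adjoint to the inclusion. -/
def summandAdjunction : summandFunctor R ⊣ P.ι :=
  Adjunction.mkOfUnitCounit
    { unit :=
        { app := fun A => (R A).proj
          naturality := fun A B f => ((R A).proj_incl_comp (R B).prop (f ≫ (R B).proj)).symm }
      counit :=
        { app := fun X => ObjectProperty.homMk (R X.obj).incl
          naturality := fun X Y f => ObjectProperty.hom_ext _ (by
            have := (R Y.obj).comp_proj_comp_incl (R X.obj).prop ((R X.obj).incl ≫ f.hom)
            rw [Category.assoc (R X.obj).incl] at this
            exact this) }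
      left_triangle := NatTrans.ext (funext fun A => ObjectProperty.hom_ext _ (by
        change ((R A).incl ≫ (R A).proj ≫ (R (R A).obj).proj) ≫ 𝟙 _ ≫ (R (R A).obj).incl = 𝟙 _
        have := (R (R A).obj).comp_proj_incl (R A).prop (𝟙 _)
        rw [← Category.assoc (R A).incl, (R A).incl_proj, Category.id_comp, Category.id_comp]
        rwa [Category.id_comp] at this))
      right_triangle := NatTrans.ext (funext fun X => by
        change (R X.obj).proj ≫ 𝟙 _ ≫ (R X.obj).incl = 𝟙 _
        have := (R X.obj).comp_proj_incl X.property (𝟙 _)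
        rwa [Category.id_comp] at this ⊢) }

/-- Coproducts are preserved by a left adjoint, the unit by definition, and truth because the
inclusions of summands are total. -/
theorem isEffectusFunctor_summandFunctor [P.IsClosedUnderFiniteCoproducts] :
    letI := fullSubcategoryEffectus (R Effectus.unit)
    IsEffectusFunctor (summandFunctor R) := by
  let := fullSubcategoryEffectus (R Effectus.unit)
  refine ⟨fun A B => ⟨?_, fun f g h hh => ?_⟩, ?_, Iso.refl _, fun A => ?_⟩
  · refine ObjectProperty.hom_ext _ ?_
    change (R A).incl ≫ PCM.zero ≫ (R B).proj = PCM.zero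
    rw [pcm_zero_comp, comp_pcm_zero]
  · exact fullSubcategory_oplus_iff.2 (comp_oplus _ (oplus_comp hh _))
  · have := (summandAdjunction R).leftAdjoint_preservesColimits
    exact ⟨fun n => inferInstance⟩
  · refine (Category.comp_id _).trans (ObjectProperty.hom_ext _ ?_)
    change (R A).incl ≫ Effectus.truth A ≫ _ = Effectus.truth (R A).obj ≫ _
    rw [← Category.assoc, show (R A).incl ≫ _ = _ from isTotal_of_comp_eq_id (R A).incl_proj]

end FullSubcategory

/-! ### The product decomposition. -/

section Decomposition

variable {C : Type u} [Category.{v} C] [Effectus C] {s t : (Effectus.unit : C) ⟶ Effectus.unit}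

/-- Maps are pairs of diagonal components, since the off-diagonal ones vanish. Two given components
are summable because their truths lie below the summable truths of the two projections. -/
theorem isEquivalence_prod_summandFunctor (h : IsScalarSplitting s t)
    (R : ∀ A : C, Summand (fixedBy s) A) (S : ∀ A : C, Summand (fixedBy t) A)
    (hRS : ∀ A, PCM.oplus ((R A).proj ≫ (R A).incl) ((S A).proj ≫ (S A).incl) = some (𝟙 A)) :
    ((summandFunctor R).prod' (summandFunctor S)).IsEquivalence where
  faithful := ⟨fun {A B f g} hfg => by
    have h1 : (R A).incl ≫ f ≫ (R B).proj = (R A).incl ≫ g ≫ (R B).proj :=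
      congrArg (fun k => InducedCategory.Hom.hom (Prod.fst k)) hfg
    have h2 : (S A).incl ≫ f ≫ (S B).proj = (S A).incl ≫ g ≫ (S B).proj :=
      congrArg (fun k => InducedCategory.Hom.hom (Prod.snd k)) hfg
    have h1' : (R A).incl ≫ f = (R A).incl ≫ g := by
      rw [← (R B).comp_proj_comp_incl (R A).prop ((R A).incl ≫ f), Category.assoc _ f, h1,
        ← Category.assoc _ g, (R B).comp_proj_comp_incl (R A).prop]
    have h2' : (S A).incl ≫ f = (S A).incl ≫ g := by
      rw [← (S B).comp_proj_comp_incl (S A).prop ((S A).incl ≫ f), Category.assoc _ f, h2,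
        ← Category.assoc _ g, (S B).comp_proj_comp_incl (S A).prop]
    have e1 := oplus_comp (hRS A) f
    have e2 := oplus_comp (hRS A) g
    rw [Category.assoc, Category.assoc, Category.id_comp] at e1 e2
    rw [h1', h2', e2] at e1
    exact (Option.some.inj e1).symm⟩
  full := ⟨fun {A B} k => by
    obtain ⟨⟨g1 : (R A).obj ⟶ (R B).obj⟩, ⟨g2 : (S A).obj ⟶ (S B).obj⟩⟩ := k
    obtain ⟨f, hf⟩ : Perp ((R A).proj ≫ g1 ≫ (R B).incl)
        ((S A).proj ≫ g2 ≫ (S B).incl) := by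
      refine Effectus.perp_of_comp_truth _ _ ?_
      have e := oplus_comp (hRS A) (Effectus.truth A)
      rw [Category.assoc, Category.assoc,
        show (R A).incl ≫ _ = _ from isTotal_of_comp_eq_id (R A).incl_proj,
        show (S A).incl ≫ _ = _ from isTotal_of_comp_eq_id (S A).incl_proj] at e
      refine Perp.mono ⟨_, e⟩ ?_ ?_
      · rw [Category.assoc]
        exact comp_pLe _ (pLe_truth _)
      · rw [Category.assoc]
        exact comp_pLe _ (pLe_truth _)
    have hRS0 : (R A).incl ≫ (S A).proj = PCM.zero := h.hom_eq_zero (R A).prop (S A).prop _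
    have hSR0 : (S A).incl ≫ (R A).proj = PCM.zero := h.symm.hom_eq_zero (S A).prop (R A).prop _
    have e1 : (R A).incl ≫ f ≫ (R B).proj = g1 := by
      have e := comp_oplus (R A).incl hf
      rw [← Category.assoc _ (S A).proj, hRS0, pcm_zero_comp, ← Category.assoc, (R A).incl_proj,
        Category.id_comp, PCM.oplus_comm, PCM.zero_oplus] at e
      rw [← Category.assoc, ← Option.some.inj e, (R B).comp_incl_comp_proj]
    have e2 : (S A).incl ≫ f ≫ (S B).proj = g2 := by
      have e := comp_oplus (S A).incl hf
      rw [← Category.assoc _ (R A).proj, hSR0, pcm_zero_comp, PCM.zero_oplus, ← Category.assoc,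
        (S A).incl_proj, Category.id_comp] at e
      rw [← Category.assoc, ← Option.some.inj e, (S B).comp_incl_comp_proj]
    exact ⟨f, Prod.ext (ObjectProperty.hom_ext _ e1) (ObjectProperty.hom_ext _ e2)⟩⟩
  essSurj := ⟨fun ⟨X, Y⟩ => by
    let R' := R (X.obj ⨿ Y.obj)
    let S' := S (X.obj ⨿ Y.obj)
    -- The `t`-part of the coproduct meets only `X` and its `s`-part only `Y` when `X` is fixed by
    -- `t`; in general the vanishing cross maps identify the two parts of `X ⨿ Y` with `X` and `Y`.
    have e1 : coprod.desc (𝟙 X.obj) PCM.zero ≫ coprod.inl ≫ R'.proj = R'.proj := by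
      refine coprod.hom_ext ?_ ?_
      · rw [coprod.inl_desc_assoc, Category.id_comp]
      · rw [coprod.inr_desc_assoc, pcm_zero_comp]
        exact (h.symm.hom_eq_zero Y.property R'.prop _).symm
    have e2 : coprod.desc PCM.zero (𝟙 Y.obj) ≫ coprod.inr ≫ S'.proj = S'.proj := by
      refine coprod.hom_ext ?_ ?_
      · rw [coprod.inl_desc_assoc, pcm_zero_comp]
        exact (h.hom_eq_zero X.property S'.prop _).symm
      · rw [coprod.inr_desc_assoc, Category.id_comp]
    let i1 : R'.obj ≅ X.obj :=
      { hom := R'.incl ≫ coprod.desc (𝟙 X.obj) PCM.zero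
        inv := coprod.inl ≫ R'.proj
        hom_inv_id := by rw [Category.assoc, e1, R'.incl_proj]
        inv_hom_id := by
          rw [← Category.assoc, R'.comp_proj_comp_incl X.property, coprod.inl_desc] }
    let i2 : S'.obj ≅ Y.obj :=
      { hom := S'.incl ≫ coprod.desc PCM.zero (𝟙 Y.obj)
        inv := coprod.inr ≫ S'.proj
        hom_inv_id := by rw [Category.assoc, e2, S'.incl_proj]
        inv_hom_id := by
          rw [← Category.assoc, S'.comp_proj_comp_incl Y.property, coprod.inr_desc] }
    exact ⟨X.obj ⨿ Y.obj, ⟨Iso.prod (ObjectProperty.isoMk _ i1) (ObjectProperty.isoMk _ i2)⟩⟩⟩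

end Decomposition

/-! ### Predicates of the two factors. -/

section PredicateFunctor

variable {D : Type u} [Category.{v} D] [Effectus D]

theorem exists_predFunctor_lift_OA (h : ∀ A : D, IsOrthoalgebra (Predicate A)) :
    ∃ P : D ⥤ OA.{v}ᵒᵖ, P ⋙ OA.incl.op = predFunctor D :=
  ⟨{ obj := fun A => op ⟨((predFunctor D).obj A).unop, h A⟩
     map := fun f => (ObjectProperty.homMk ((predFunctor D).map f).unop).op
     map_id := fun A => by rw [(predFunctor D).map_id]; rfl
     map_comp := fun f g => by rw [(predFunctor D).map_comp]; rfl }, rfl⟩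

/-- If the unit scalar has a half, then the predicate functor of a directed-complete effectus lifts
to convex effect algebras. -/
theorem exists_predFunctor_lift_DCEAc (hdc : DirectedCompleteEffectus D)
    {m : (Effectus.unit : D) ⟶ Effectus.unit} (hm : PCM.oplus m m = some (𝟙 _)) :
    ∃ P : D ⥤ DCEAc.{v}ᵒᵖ, P ⋙ DCEAc.forget.op = predFunctor D := by
  have hhalf : ∀ A : D, IsHalving (fun p : Predicate A => p ≫ m) := fun A =>
    ⟨PCMEnriched.comp_additive_left m, fun p => by
      have := comp_oplus p hm
      rwa [Category.comp_id] at this⟩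
  choose act hact using fun A : D =>
    exists_convexAction (Effectus.isEffectAlgebra A) (hhalf A) (hdc A)
  -- The map `l ↦ f ≫ (act B).act l p` is additive, so it is the orbit of its value `f ≫ p` at `1`.
  have hmap : ∀ {A B : D} (f : A ⟶ B) l (p : Predicate B),
      f ≫ (act B).act l p = (act A).act l (f ≫ p) := by
    intro A B f l p
    have := hact A (fun l => f ≫ (act B).act l p)
      (fun l m n h => comp_oplus f ((act B).act_add l m n p h)) l
    simpa only [(act B).one_act] using this
  exact ⟨{
    obj := fun A => op ⟨((predFunctor D).obj A).unop, act A, hdc A⟩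
    map := fun f => Quiver.Hom.op ⟨((predFunctor D).map f).unop, hmap f⟩
    map_id := fun A => Quiver.Hom.unop_inj (DCEAc.Hom.ext
      (congrArg Quiver.Hom.unop ((predFunctor D).map_id A)))
    map_comp := fun f g => Quiver.Hom.unop_inj (DCEAc.Hom.ext
      (congrArg Quiver.Hom.unop ((predFunctor D).map_comp f g))) }, rfl⟩

end PredicateFunctor

section ScalarPart

variable {C : Type u} [Category.{v} C] [Effectus C] {s : (Effectus.unit : C) ⟶ Effectus.unit}

/-- A total map into the unit object is the truth predicate, on which `s` acts as the identity by
assumption. -/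
theorem Summand.incl_comp_scalar (R : Summand (fixedBy s) (Effectus.unit : C)) :
    R.incl ≫ s = R.incl := by
  have h1 : R.incl = Effectus.truth R.obj := by
    have := isTotal_of_comp_eq_id R.incl_proj
    rwa [IsTotal, truth_unit, Category.comp_id] at this
  rw [h1]
  exact R.prop

/-- The value of a self-summable predicate at a state is a self-summable scalar, hence killed by
`s`. Landing in the summand, it is also fixed by `s`, so it is zero, and states separate. -/
theorem isOrthoalgebra_of_scalars (hstates : SeparatedByStates C)
    (hs : ∀ c : (Effectus.unit : C) ⟶ Effectus.unit, Perp c c → c ≫ s = PCM.zero)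
    (R : Summand (fixedBy s) (Effectus.unit : C)) (A : (fixedBy s).FullSubcategory) :
    letI := fullSubcategoryEffectus R
    IsOrthoalgebra (Predicate A) := by
  intro a ha
  have ha' := (PCMEnriched.comp_additive_left R.incl).perp (fullSubcategory_perp_iff.1 ha)
  have h0 : a.hom ≫ R.incl = PCM.zero := hstates _ _ _ _ fun ω _ => by
    have := hs _ ((PCMEnriched.comp_additive_right ω).perp ha')
    rwa [Category.assoc, Category.assoc, R.incl_comp_scalar, ← comp_pcm_zero ω] at this
  refine ObjectProperty.hom_ext _ ?_
  rw [← R.comp_incl_comp_proj a.hom, h0, pcm_zero_comp]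
  rfl

theorem directedComplete_fullSubcategory {P : ObjectProperty C} [P.IsClosedUnderFiniteCoproducts]
    (hdc : DirectedCompleteEffectus C) (R : Summand P (Effectus.unit : C)) :
    letI := fullSubcategoryEffectus R
    DirectedCompleteEffectus P.FullSubcategory := by
  intro A U hU
  obtain ⟨z, hz1, hz2⟩ := hdc A.obj ((fun a => a.hom ≫ R.incl) '' U) (by
    rintro _ ⟨a, ha, rfl⟩ _ ⟨b, hb, rfl⟩
    obtain ⟨c, hc, hac, hbc⟩ := hU a ha b hb
    exact ⟨_, ⟨c, hc, rfl⟩, pLe_comp (fullSubcategory_pLe_iff.1 hac) _,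
      pLe_comp (fullSubcategory_pLe_iff.1 hbc) _⟩)
  refine ⟨ObjectProperty.homMk (z ≫ R.proj), fun a ha => ?_, fun b hb => ?_⟩
  · have := pLe_comp (hz1 _ ⟨a, ha, rfl⟩) R.proj
    rw [R.comp_incl_comp_proj] at this
    exact fullSubcategory_pLe_iff.2 this
  · have := pLe_comp (hz2 (b.hom ≫ R.incl) (by
      rintro _ ⟨a, ha, rfl⟩
      exact pLe_comp (fullSubcategory_pLe_iff.1 (hb a ha)) _)) R.proj
    rw [R.comp_incl_comp_proj] at this
    exact fullSubcategory_pLe_iff.2 this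

theorem exists_half_scalar {h : (Effectus.unit : C) ⟶ Effectus.unit} (hs : PCM.oplus h h = some s)
    (R : Summand (fixedBy s) (Effectus.unit : C)) :
    letI := fullSubcategoryEffectus R
    ∃ m : (Effectus.unit : (fixedBy s).FullSubcategory) ⟶ Effectus.unit,
      PCM.oplus m m = some (𝟙 _) := by
  have := comp_oplus R.incl (oplus_comp hs R.proj)
  rw [← Category.assoc _ s, R.incl_comp_scalar, R.incl_proj] at this
  exact ⟨ObjectProperty.homMk (R.incl ≫ h ≫ R.proj), fullSubcategory_oplus_iff.2 this⟩

end ScalarPart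

end EffTheory

open EffTheory
theorem proposition3p12 {C : Type u} [Category.{v} C] [Effectus C]
    (hdc : DirectedCompleteEffectus C)
    (hstates : SeparatedByStates C)
    (himages : EffHasImages C)
    (hfilters : HasFilters C)
    (hcompr : HasComprehensions C)
    (hcompat : FiltersComprehensionsCompatible C) :
    (DCOUS.interval.{v}).IsEquivalence ∧
    ∃ (C₁ : Type u) (_ : Category.{v} C₁) (_ : Effectus C₁)
      (C₂ : Type u) (_ : Category.{v} C₂) (_ : Effectus C₂)
      (e : C ≌ C₁ × C₂),
      IsEffectusFunctor (e.functor ⋙ CategoryTheory.Prod.fst C₁ C₂) ∧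
      IsEffectusFunctor (e.functor ⋙ CategoryTheory.Prod.snd C₁ C₂) ∧
      (∃ P₁ : C₁ ⥤ OA.{v}ᵒᵖ, P₁ ⋙ OA.incl.op = predFunctor C₁) ∧
      (∃ P₂ : C₂ ⥤ DCEAc.{v}ᵒᵖ, P₂ ⋙ DCEAc.forget.op = predFunctor C₂ ∧
        ∃ Q₂ : C₂ ⥤ DCOUS.{v}ᵒᵖ, Nonempty (Q₂ ⋙ DCOUS.interval.op ≅ P₂)) := by
  have := DCOUS.interval_isEquivalence.{v}
  refine ⟨this, ?_⟩
  obtain ⟨s, t, h, hst, hs, ht⟩ := exists_scalarSplitting (hdc (Effectus.unit : C))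
  -- With the splitting reversed, `R` is the part fixed by `t`, giving the orthoalgebras, and `S`
  -- the part fixed by `s`, where the unit scalar has a half.
  choose R S hRS using exists_summands hstates himages hcompr hcompat hst.symm
  have heq := isEquivalence_prod_summandFunctor hst.symm R S hRS
  let := fullSubcategoryEffectus (R Effectus.unit)
  let := fullSubcategoryEffectus (S Effectus.unit)
  obtain ⟨m, hm⟩ := exists_half_scalar hs (S Effectus.unit)
  obtain ⟨P₂, hP₂⟩ := exists_predFunctor_lift_DCEAc
    (directedComplete_fullSubcategory hdc (S Effectus.unit)) hm
  exact ⟨(fixedBy t).FullSubcategory, inferInstance, inferInstance,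
    (fixedBy s).FullSubcategory, inferInstance, inferInstance,
    ((summandFunctor R).prod' (summandFunctor S)).asEquivalence,
    isEffectusFunctor_summandFunctor R, isEffectusFunctor_summandFunctor S,
    exists_predFunctor_lift_OA (isOrthoalgebra_of_scalars hstates ht (R Effectus.unit)),
    P₂, hP₂, P₂ ⋙ DCOUS.interval.inv.op,
    ⟨Functor.isoWhiskerLeft P₂ (NatIso.op DCOUS.interval.asEquivalence.counitIso.symm)⟩⟩
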